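/- For integers $m,n\ge 3$ and $l\ge -1$, let the *semicomplete dumbbell* $\widetilde D(m,l,n)$ be the simple graph on $m+l+n$ vertices that consists of a cycle $C_m$ and a complete graph $K_n$ linked by a path $P_l$ on $l$ vertices: for $l\ge 1$, one end of $P_l$ is joined by an edge to one vertex of $C_m$ and the other end is joined by an edge to one vertex of $K_n$ (for $l=1$ both ends are the single vertex of $P_1$); for $l=0$, one vertex of $C_m$ is joined by an edge to one vertex of $K_n$; for $l=-1$, $C_m$ and $K_n$ share exactly one vertex. For a finite simple graph $G=(V,E)$ let $$X_G=\sum_{\kappa}\prod_{v\in V}x_{\kappa(v)}\in\mathbb{Q}[[x_0,x_1,x_2,\ldots]]$$ be its chromatic symmetric function, where the sum is over all proper colourings $\kappa:V\to\mathbb{N}$ of $G$. A symmetric function is called *$e$-positive* if it is a finite linear combination, with nonnegative coefficients, of the functions $e_\lambda=e_{\lambda_1}e_{\lambda_2}\cdots$, where $\lambda$ ranges over all integer partitions and $e_i=\sum_{j_1<\cdots<j_i}x_{j_1}\cdots x_{j_i}$. **Theorem.** (1) For all $m,n\ge 3$ and $l\ge -1$, the chromatic symmetric function $X_{\widetilde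 D(m,l,n)}$ is $e$-positive. (2) For all $m,n,m',n'\ge 3$ and $l,l'\ge -1$, if $\widetilde D(m,l,n)$ and $\widetilde D(m',l',n')$ are not isomorphic, then $X_{\widetilde D(m,l,n)}\ne X_{\widetilde D(m',l',n')}$. -/

import Mathlib

/-- The chromatic symmetric function of a finite simple graph `G`, as a formal power series in the
countably many variables `x₀, x₁, x₂, …` over `ℚ`: the sum of `∏ v, x_{κ v}` over all proper
colourings `κ : V → ℕ` of `G`. So its coefficient at the monomial `d` is the (finite) number of
proper colourings `κ` that use each colour `i` exactly `d i` times. -/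
noncomputable def chromaticSymmetricFunction {V : Type*} [Fintype V] (G : SimpleGraph V) :
    MvPowerSeries ℕ ℚ :=
  fun d => (Nat.card {κ : G.Coloring ℕ // ∑ v, Finsupp.single (κ v) 1 = d} : ℚ)

/-- Only finitely many proper colourings contribute to a given monomial, so the cardinality in
`chromaticSymmetricFunction` is a genuine count. -/
theorem finite_coloring_monomial {V : Type*} [Fintype V] (G : SimpleGraph V) (d : ℕ →₀ ℕ) :
    Finite {κ : G.Coloring ℕ // ∑ v, Finsupp.single (κ v) 1 = d} := by
  have h : ∀ (κ : {κ : G.Coloring ℕ // ∑ v, Finsupp.single (κ v) 1 = d}) (v : V),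
      κ.1 v ∈ d.support := by
    rintro ⟨κ, rfl⟩ v
    rw [Finsupp.mem_support_iff, Finsupp.finsetSum_apply]
    intro h0
    have := (Finset.sum_eq_zero_iff.mp h0) v (Finset.mem_univ v)
    simp at this
  refine Finite.of_injective (β := V → d.support) (fun κ v => ⟨κ.1 v, h κ v⟩) ?_
  intro κ₁ κ₂ h12
  apply Subtype.ext
  apply RelHom.ext
  intro v
  exact congrArg Subtype.val (congrFun h12 v)

/-- The elementary symmetric function `e_i = ∑_{j₁ < ⋯ < j_i} x_{j₁} ⋯ x_{j_i}` in the variables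
`x₀, x₁, x₂, …`: the sum of all squarefree monomials of degree `i`. -/
noncomputable def elemSymm (i : ℕ) : MvPowerSeries ℕ ℚ :=
  open Classical in fun d => if (∀ j, d j ≤ 1) ∧ d.degree = i then 1 else 0

/-- `e_λ = e_{λ₁} e_{λ₂} ⋯` for a partition `λ` of `k`. -/
noncomputable def elemSymmPart {k : ℕ} (p : k.Partition) : MvPowerSeries ℕ ℚ :=
  (p.parts.map elemSymm).prod

/-- `f` is `e`-positive: `f` is a (finite) linear combination of the functions `e_λ`, where `λ`
ranges over all partitions of all natural numbers, with nonnegative coefficients. -/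
def IsEPositive (f : MvPowerSeries ℕ ℚ) : Prop :=
  ∃ c : (Σ k : ℕ, k.Partition) →₀ ℚ, (∀ p, 0 ≤ c p) ∧
    f = c.sum fun p a => a • elemSymmPart p.2

/-- The semicomplete dumbbell `D̃(m, l, n)`, for `m, n ≥ 3` and `l ≥ -1`, on the `m + l + n`
vertices `0, 1, …, m + l + n - 1`. The vertices `0, …, m - 1` form the cycle `C_m`, the vertices
`m, …, m + l - 1` form the path `P_l`, and the vertices `m + l, …, m + l + n - 1` form the complete
graph `K_n`. The path is attached at the vertex `m - 1` of the cycle and at the vertex `m + l` of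
the complete graph; for `l = 0` these two vertices are adjacent, for `l = -1` they coincide. -/
def semicompleteDumbbell (m : ℕ) (l : ℤ) (n : ℕ) : SimpleGraph (Fin (m + l + n : ℤ).toNat) :=
  SimpleGraph.fromRel fun a b =>
    -- the edges of the cycle
    (a.val + 1 = b.val ∧ b.val < m) ∨ (a.val = 0 ∧ b.val + 1 = m) ∨
    -- the edges of the path and the edges that attach it
    (m ≤ a.val + 1 ∧ a.val + 1 = b.val ∧ (b.val : ℤ) ≤ m + l) ∨
    -- the edges of the complete graph
    (m + l ≤ (a.val : ℤ) ∧ m + l ≤ (b.val : ℤ))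

/-! Put `b = m - 1`, `d = l + 1`, `p = n - 1`, and let `E = ∑ e_i X^i`. In finitely many variables,
a proper colouring of the dumbbell is a proper walk of colours `u 0, …, u (b + d)` with `u 0 ≠ u b`
(the cycle, then the path up to the attaching vertex of `K_n`), together with `p` distinct colours
avoiding the last one. If that last colour is `k`, the clique contributes `p!` times `e_p` in the
variables other than `x_k`, and this `e_p` is the sum over `i ≤ p` of `(1 - i) e_i` times the weight
of a tail of `p - i` vertices. Hence the chromatic function is `p!` times a signed sum of tadpoles
(`rootedCycleSum_coeff_elemSeries`), and tadpoles are expressed by the path series `P = E / (E - X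
E')` and the cycle series `C = X² E'' / (E - X E')`.

Positivity: `E - X E' = 1 - F` with `F = ∑ (i - 1) e_i X^i` over `i ≥ 1`, so `1 / (1 - F)` is
positive, and so are tadpoles. Extend the signed sum from `i ≤ p` to `i ≤ a = d + p`; the correction
is a positive combination of tadpoles. In the extended sum, `C P = X P' - P + 1` leaves a positive
multiple of `e_N` (`N` the number of vertices) plus a sum over `i > a`, `i + j ≤ N` of `j ((i - 1)(i
- a) - (j - 1)) e_i e_j` times a coefficient of `1 / (1 - F)`. Single weights may be negative, but
adding the weights of `(i, j)` and `(j, i)` gives something nonnegative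
(`symmetrized_coefficient_nonneg`, `dumbbellSeries_mem`).

Distinguishing: the number of vertices and the chromatic polynomial, both determined by the
chromatic function, already recover `b`, `d` and `p` (`eq_of_chromaticSymmetricFunction_eq`). -/

/-- The sum of `∏ v, x (κ v)` over all proper colourings `κ : V → K` of `G`. -/
noncomputable def colouringSum {V K R : Type*} [Fintype V] [DecidableEq V] [Fintype K] [CommRing R]
    (G : SimpleGraph V) (x : K → R) : R :=
  open Classical in ∑ κ : V → K, if ∀ a b, G.Adj a b → κ a ≠ κ b then ∏ v, x (κ v) else 0

theorem map_colouringSum {V K R R' : Type*} [Fintype V] [DecidableEq V] [Fintype K] [CommRing R]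
    [CommRing R'] (φ : R →+* R') (G : SimpleGraph V) (x : K → R) :
    φ (colouringSum G x) = colouringSum G (fun k => φ (x k)) := by
  classical
  simp only [colouringSum, map_sum]
  refine Finset.sum_congr rfl fun κ _ => ?_
  split_ifs <;> simp

theorem colouringSum_const {V K R : Type*} [Fintype V] [DecidableEq V] [Fintype K] [CommRing R]
    (G : SimpleGraph V) (t : R) :
    colouringSum G (fun _ : K => t) =
      t ^ Fintype.card V * colouringSum G (fun _ : K => (1 : R)) := by
  classical
  simp only [colouringSum, Finset.prod_const, Finset.card_univ, one_pow, Finset.mul_sum, mul_ite,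
    mul_one, mul_zero]

/-! ### Transfer operator; paths, cycles and tadpoles. -/

section Step

variable {K R : Type*} [Fintype K] [CommRing R]

/-- The transfer operator of a proper walk on colours: sums `x c * g c` over all `c ≠ k`. -/
noncomputable def step (x : K → R) : Module.End R (K → R) where
  toFun g := fun k => ∑ c, x c * g c - x k * g k
  map_add' g h := by
    ext k; simp only [Pi.add_apply, mul_add, Finset.sum_add_distrib]; ring
  map_smul' a g := by
    ext k
    simp only [Pi.smul_apply, smul_eq_mul, RingHom.id_apply, mul_sub, Finset.mul_sum]
    congr 1
    · exact Finset.sum_congr rfl fun c _ => by ring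
    · ring

theorem step_apply (x g : K → R) (k : K) : step x g k = ∑ c, x c * g c - x k * g k := rfl

/-- `step x` is self-adjoint for the form `∑ x_k f_k g_k`: its rank-one part and its diagonal part
both are. -/
theorem sum_mul_step (x f g : K → R) :
    ∑ k, x k * (f k * step x g k) = ∑ k, x k * (step x f k * g k) := by
  simp only [step_apply, mul_sub, sub_mul, Finset.sum_sub_distrib]
  congr 1
  · simp only [Finset.mul_sum, Finset.sum_mul]
    rw [Finset.sum_comm]
    exact Finset.sum_congr rfl fun _ _ => Finset.sum_congr rfl fun _ _ => by ring
  · exact Finset.sum_congr rfl fun _ _ => by ring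

theorem sum_mul_step_pow (x : K → R) (j : ℕ) (f g : K → R) :
    ∑ k, x k * (f k * (step x ^ j) g k) = ∑ k, x k * ((step x ^ j) f k * g k) := by
  induction j generalizing f with
  | zero => simp
  | succ j ih =>
    rw [pow_succ' (step x) j, Module.End.mul_apply, sum_mul_step, ih, ← Module.End.mul_apply,
      ← pow_succ, ← pow_succ']

/-- The sum of the weights of the proper walks that extend a walk ending in `k` by `j` steps. -/
noncomputable def walkSum (x : K → R) (j : ℕ) : K → R := (step x ^ j) 1

theorem walkSum_zero (x : K → R) : walkSum x 0 = 1 := by simp [walkSum]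

/-- The chromatic symmetric polynomial of the path on `j` vertices. -/
noncomputable def pathSum (x : K → R) : ℕ → R
  | 0 => 1
  | j + 1 => ∑ k, x k * walkSum x j k

theorem walkSum_succ (x : K → R) (j : ℕ) (k : K) :
    walkSum x (j + 1) k = pathSum x (j + 1) - x k * walkSum x j k := by
  rw [walkSum, pow_succ', Module.End.mul_apply, step_apply]; rfl

theorem step_pow_walkSum (x : K → R) (i j : ℕ) :
    (step x ^ i) (walkSum x j) = walkSum x (i + j) := by
  rw [walkSum, walkSum, pow_add, Module.End.mul_apply]

/-- Two tails glued at a common vertex form a path; self-adjointness moves all steps to one side. -/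
theorem sum_walkSum_mul_walkSum (x : K → R) (i j : ℕ) :
    ∑ k, x k * (walkSum x i k * walkSum x j k) = pathSum x (i + j + 1) := by
  conv_lhs => rw [walkSum.eq_1 x j, sum_mul_step_pow, step_pow_walkSum]
  simp [pathSum, add_comm]

variable [DecidableEq K]

theorem step_apply_eq_sum_ite (x g : K → R) (k : K) :
    step x g k = ∑ c, if k ≠ c then x c * g c else 0 := by
  rw [step_apply, sub_eq_iff_eq_add]
  have h : x k * g k = ∑ c, if k = c then x c * g c else 0 := by simp
  rw [h, ← Finset.sum_add_distrib]
  refine Finset.sum_congr rfl fun c _ => ?_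
  by_cases h : k = c <;> simp [h]

/-- The chromatic symmetric polynomial of the cycle on `m + 1` vertices, with the weight `g` at the
colour of one vertex. -/
noncomputable def rootedCycleSum (x : K → R) (m : ℕ) : (K → R) →ₗ[R] R where
  toFun g := ∑ k, x k * (step x ^ m) (fun c => if k ≠ c then g c else 0) k
  map_add' g h := by
    rw [← Finset.sum_add_distrib]
    refine Finset.sum_congr rfl fun k _ => ?_
    have : (fun c => if k ≠ c then (g + h) c else 0) =
        (fun c => if k ≠ c then g c else 0) + fun c => if k ≠ c then h c else 0 := by
      funext c
      by_cases hc : k = c <;> simp [hc]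
    rw [this, map_add, Pi.add_apply, mul_add]
  map_smul' a g := by
    simp only [RingHom.id_apply, smul_eq_mul, Finset.mul_sum]
    refine Finset.sum_congr rfl fun k _ => ?_
    have : (fun c => if k ≠ c then (a • g) c else 0) =
        a • fun c => if k ≠ c then g c else 0 := by
      funext c
      by_cases hc : k = c <;> simp [hc]
    rw [this, map_smul, Pi.smul_apply, smul_eq_mul, mul_left_comm]

theorem rootedCycleSum_apply (x : K → R) (m : ℕ) (g : K → R) : rootedCycleSum x m g =
    ∑ k, x k * (step x ^ m) (fun c => if k ≠ c then g c else 0) k := rfl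

/-- The contribution of the closed walks of `m` steps. -/
noncomputable def closedWalkSum (x : K → R) (m : ℕ) (g : K → R) : R :=
  ∑ k, x k * (g k * (step x ^ m) (Pi.single k 1) k)

/-- Deletion of the closing edge: all walks, minus those that return to their starting colour. -/
theorem rootedCycleSum_eq (x : K → R) (m : ℕ) (g : K → R) :
    rootedCycleSum x m g = ∑ k, x k * (step x ^ m) g k - closedWalkSum x m g := by
  rw [rootedCycleSum_apply, closedWalkSum, ← Finset.sum_sub_distrib]
  refine Finset.sum_congr rfl fun k _ => ?_
  have : (fun c => if k ≠ c then g c else 0) = g - g k • (Pi.single k 1 : K → R) := by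
    ext c
    by_cases h : k = c
    · subst h; simp
    · simp [h, Ne.symm h]
  rw [this, map_sub, map_smul]
  simp [mul_sub]

/-- The chromatic symmetric polynomial of the cycle on `m + 1` vertices with a tail of `j`
vertices. -/
noncomputable def tadpoleSum (x : K → R) (m j : ℕ) : R := rootedCycleSum x m (walkSum x j)

theorem tadpoleSum_eq (x : K → R) (m j : ℕ) :
    tadpoleSum x m j = pathSum x (m + j + 1) - closedWalkSum x m (walkSum x j) := by
  rw [tadpoleSum, rootedCycleSum_eq, step_pow_walkSum]; rfl

theorem tadpoleSum_zero (x : K → R) (j : ℕ) : tadpoleSum x 0 j = 0 := by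
  rw [tadpoleSum_eq]
  simp [closedWalkSum, pathSum]

/-- Trades one step of the closed walk for one vertex of the tail: unfold one `step`, then absorb
its factor `x k` by `walkSum_succ`. -/
theorem closedWalkSum_succ (x : K → R) (m j : ℕ) :
    closedWalkSum x (m + 1) (walkSum x j) = pathSum x (j + 1) * tadpoleSum x m 0
      - pathSum x (m + j + 2) + closedWalkSum x m (walkSum x (j + 1)) := by
  have key : ∀ k, x k * (walkSum x j k * (step x ^ (m + 1)) (Pi.single k 1) k) =
      pathSum x (j + 1) * (x k * walkSum x m k)
      - x k * (walkSum x (j + 1) k * walkSum x m k)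
      - pathSum x (j + 1) * (x k * (walkSum x 0 k * (step x ^ m) (Pi.single k 1) k))
      + x k * (walkSum x (j + 1) k * (step x ^ m) (Pi.single k 1) k) := by
    intro k
    -- Self-adjointness against the constant function `1` turns this sum into a walk sum at `k`.
    have h1 : ∑ c, x c * (step x ^ m) (Pi.single k 1) c = x k * walkSum x m k := by
      have := sum_mul_step_pow x m 1 (Pi.single k 1)
      simp only [Pi.one_apply, one_mul] at this
      rw [this, Finset.sum_eq_single k]
      · simp [walkSum]
      · intro b _ hb; simp [hb]
      · simp
    rw [pow_succ', Module.End.mul_apply, step_apply, h1, walkSum_succ, walkSum_zero, Pi.one_apply]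
    ring
  rw [closedWalkSum, Finset.sum_congr rfl fun k _ => key k]
  simp only [Finset.sum_add_distrib, Finset.sum_sub_distrib, ← Finset.mul_sum]
  rw [sum_walkSum_mul_walkSum, tadpoleSum_eq, closedWalkSum, closedWalkSum, mul_sub]
  have : m + j + 2 = j + 1 + m + 1 := by ring
  rw [this]
  simp only [pathSum]
  ring

theorem tadpoleSum_succ (x : K → R) (m j : ℕ) : tadpoleSum x (m + 1) j =
    tadpoleSum x m (j + 1) + pathSum x (m + j + 2) - tadpoleSum x m 0 * pathSum x (j + 1) := by
  rw [tadpoleSum_eq, closedWalkSum_succ, tadpoleSum_eq x m (j + 1)]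
  have h1 : m + 1 + j + 1 = m + j + 2 := by ring
  have h2 : m + (j + 1) + 1 = m + j + 2 := by ring
  rw [h1, h2]
  ring

/-- Iterating `tadpoleSum_succ` shrinks the cycle until it has one vertex, where the sum vanishes.
-/
theorem tadpoleSum_eq_sum (x : K → R) (m j : ℕ) : tadpoleSum x m j =
    m * pathSum x (m + j + 1) -
      ∑ r ∈ Finset.range m, tadpoleSum x r 0 * pathSum x (m + j - r) := by
  induction m generalizing j with
  | zero => simp [tadpoleSum_zero]
  | succ m ih =>
    rw [tadpoleSum_succ, ih, Finset.sum_range_succ]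
    have h1 : m + 1 + j - m = j + 1 := by omega
    have h2 : m + (j + 1) = m + 1 + j := by ring
    have h3 : m + j + 2 = m + 1 + j + 1 := by ring
    rw [h1, h2, h3]
    push_cast
    ring

end Step

/-! ### Generating functions in terms of `E`. -/

section GeneratingFunctions

open PowerSeries

variable {R : Type*} [CommRing R]

/-- For `E = ∑ e_i X^i`, the series `∑ (1 - i) e_i X^i`. -/
noncomputable def subXDeriv (E : R⟦X⟧) : R⟦X⟧ := E - X * d⁄dX R E

/-- The inverse of `subXDeriv E`. -/
noncomputable def invSeries (E : R⟦X⟧) : R⟦X⟧ := invOfUnit (subXDeriv E) 1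

/-- For `E = ∑ e_i X^i`, the generating function of the chromatic symmetric functions of paths. -/
noncomputable def pathSeries (E : R⟦X⟧) : R⟦X⟧ := E * invSeries E

/-- For `E = ∑ e_i X^i`, the generating function of the chromatic symmetric functions of cycles. -/
noncomputable def cycleSeries (E : R⟦X⟧) : R⟦X⟧ := X ^ 2 * d⁄dX R (d⁄dX R E) * invSeries E

theorem coeff_subXDeriv (E : R⟦X⟧) (i : ℕ) : coeff i (subXDeriv E) = (1 - i) * coeff i E := by
  cases i with
  | zero => simp [subXDeriv]
  | succ i =>
    simp only [subXDeriv, map_sub, coeff_succ_X_mul, coeff_derivative]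
    push_cast; ring

theorem subXDeriv_mul_invSeries {E : R⟦X⟧} (hE : constantCoeff E = 1) :
    subXDeriv E * invSeries E = 1 :=
  mul_invOfUnit _ _ (by simp [subXDeriv, hE])

theorem map_derivative_series {R' : Type*} [CommRing R'] (φ : R →+* R') (E : R⟦X⟧) :
    map φ (d⁄dX R E) = d⁄dX R' (map φ E) := by
  ext n; simp only [coeff_map, coeff_derivative, map_mul, map_add, map_natCast, map_one]

theorem map_invSeries {R' : Type*} [CommRing R'] (φ : R →+* R') {E : R⟦X⟧}
    (hE : constantCoeff E = 1) : map φ (invSeries E) = invSeries (map φ E) := by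
  have h1 := congrArg (map φ) (subXDeriv_mul_invSeries hE)
  have hE' : constantCoeff (map φ E) = 1 := by
    rw [← coeff_zero_eq_constantCoeff_apply, coeff_map, coeff_zero_eq_constantCoeff_apply, hE,
      map_one]
  have h2 := subXDeriv_mul_invSeries hE'
  have h3 : map φ (subXDeriv E) = subXDeriv (map φ E) := by
    simp [subXDeriv, map_derivative_series]
  rw [map_mul, h3, map_one] at h1
  exact (left_inv_eq_right_inv (by rw [mul_comm]; exact h1) h2)

/-- The chromatic symmetric function, divided by `p!`, of the dumbbell made of a cycle on `b + 1`
vertices and a complete graph on `p + 1` vertices at distance `d`, as a polynomial in the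
coefficients of `E = ∑ e_i X^i`. -/
noncomputable def dumbbellSeries (E : R⟦X⟧) (b d p : ℕ) : R :=
  ∑ i ∈ Finset.range (p + 1), coeff i (subXDeriv E) *
    (b * coeff (b + (d + p - i) + 1) (pathSeries E) -
      ∑ r ∈ Finset.range b, coeff (r + 1) (cycleSeries E) *
        coeff (b + (d + p - i) - r) (pathSeries E))

theorem map_dumbbellSeries {R' : Type*} [CommRing R'] (φ : R →+* R') {E : R⟦X⟧}
    (hE : constantCoeff E = 1) (b d p : ℕ) :
    φ (dumbbellSeries E b d p) = dumbbellSeries (map φ E) b d p := by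
  simp only [dumbbellSeries, map_sum, map_mul, map_sub, map_natCast, ← coeff_map, cycleSeries,
    pathSeries, map_invSeries φ hE, map_derivative_series, subXDeriv, map_pow, map_X]

theorem isUnit_of_constantCoeff_eq_one {E : R⟦X⟧} (hE : constantCoeff E = 1) : IsUnit E :=
  isUnit_iff_constantCoeff.2 (by simp [hE])

section Elementary

variable {K : Type*} (x : K → R)

/-- The generating function of the elementary symmetric polynomials in the variables in `A`. -/
noncomputable def elemSeries (A : Finset K) : R⟦X⟧ := ∏ c ∈ A, (1 + C (x c) * X)

theorem constantCoeff_elemSeries (A : Finset K) : constantCoeff (elemSeries x A) = 1 := by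
  simp [elemSeries]

section Walk

variable [Fintype K]

theorem mk_walkSum_mul (k : K) :
    mk (fun j => walkSum x j k) * (1 + C (x k) * X) = mk (pathSum x) := by
  ext n
  rw [mul_add, mul_one, mul_left_comm, map_add, coeff_C_mul]
  cases n with
  | zero => simp [walkSum_zero, pathSum]
  | succ n => simp [coeff_succ_mul_X, walkSum_succ]

theorem mk_pathSum_eq :
    mk (pathSum x) = 1 + X * ∑ k, C (x k) * mk (fun j => walkSum x j k) := by
  ext n
  cases n with
  | zero => simp [pathSum]
  | succ n => simp [pathSum, coeff_succ_X_mul, coeff_one]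

end Walk

variable [DecidableEq K]

theorem derivative_elemSeries (A : Finset K) :
    d⁄dX R (elemSeries x A) = ∑ k ∈ A, C (x k) * elemSeries x (A.erase k) := by
  induction A using Finset.induction_on with
  | empty => simp [elemSeries]
  | insert a A ha ih =>
    have h1 : elemSeries x (insert a A) = (1 + C (x a) * X) * elemSeries x A :=
      Finset.prod_insert ha
    rw [h1, Derivation.leibniz, ih, Finset.sum_insert ha, Finset.erase_insert ha]
    have h2 : d⁄dX R (1 + C (x a) * X) = C (x a) := by
      rw [map_add, Derivation.leibniz]; simp
    rw [h2, smul_eq_mul, smul_eq_mul, Finset.mul_sum, add_comm, mul_comm (elemSeries x A)]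
    congr 1
    refine Finset.sum_congr rfl fun k hk => ?_
    have hka : a ≠ k := fun h => ha (h ▸ hk)
    rw [Finset.erase_insert_of_ne hka, elemSeries, elemSeries, Finset.prod_insert]
    · ring
    · simp [ha]

variable [Fintype K]

theorem mul_elemSeries_erase (k : K) :
    (1 + C (x k) * X) * elemSeries x (Finset.univ.erase k) = elemSeries x Finset.univ :=
  Finset.mul_prod_erase _ (fun c => 1 + C (x c) * X) (Finset.mem_univ k)

theorem mk_walkSum_mul_elemSeries (k : K) :
    mk (fun j => walkSum x j k) * elemSeries x Finset.univ =
      mk (pathSum x) * elemSeries x (Finset.univ.erase k) := by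
  rw [← mul_elemSeries_erase x k, ← mul_assoc, mk_walkSum_mul]

/-- Multiply `P = 1 + X ∑ x_k W_k` by `E`, where `W_k E = P E_k` and `E_k` omits the variable `x_k`;
since `E' = ∑ x_k E_k`, this reads `P E = E + X P E'`. -/
theorem mk_pathSum_mul :
    mk (pathSum x) * subXDeriv (elemSeries x Finset.univ) = elemSeries x Finset.univ := by
  have h : mk (pathSum x) * elemSeries x Finset.univ = elemSeries x Finset.univ +
      X * (mk (pathSum x) * d⁄dX R (elemSeries x Finset.univ)) := by
    conv_lhs => rw [mk_pathSum_eq]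
    rw [add_mul, one_mul, mul_assoc, Finset.sum_mul, derivative_elemSeries]
    congr 2
    rw [Finset.mul_sum]
    refine Finset.sum_congr rfl fun k _ => ?_
    rw [mul_assoc, mk_walkSum_mul_elemSeries]; ring
  rw [subXDeriv, mul_sub, h]; ring

theorem mk_pathSum : mk (pathSum x) = pathSeries (elemSeries x Finset.univ) := by
  rw [pathSeries]
  conv_rhs => lhs; rw [← mk_pathSum_mul x]
  rw [mul_assoc, subXDeriv_mul_invSeries (constantCoeff_elemSeries x _), mul_one]

/-- This is what replaces the clique by tails: it writes `e_p` in the variables other than `x_k` as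
a combination of walk sums at `k`. -/
theorem subXDeriv_mul_mk_walkSum (k : K) :
    subXDeriv (elemSeries x Finset.univ) * mk (fun j => walkSum x j k) =
      elemSeries x (Finset.univ.erase k) := by
  have hu : IsUnit (1 + C (x k) * X) := isUnit_of_constantCoeff_eq_one (by simp)
  refine hu.mul_left_cancel ?_
  rw [mul_elemSeries_erase, mul_comm, mul_assoc, mk_walkSum_mul, mul_comm, mk_pathSum_mul]

/-- The case `j = 0` of `tadpoleSum_eq_sum` is the convolution `T P = X P' - P + 1`; differentiating
`P (E - X E') = E` then solves for `T`. -/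
theorem X_mul_mk_tadpoleSum :
    X * mk (fun m => tadpoleSum x m 0) = cycleSeries (elemSeries x Finset.univ) := by
  set E := elemSeries x Finset.univ with hE
  set P := mk (pathSum x) with hP
  set T := X * mk (fun m => tadpoleSum x m 0) with hT
  have hPG : P * subXDeriv E = E := mk_pathSum_mul x
  have h1 : T * P = X * d⁄dX R P - P + 1 := by
    have h2 : mk (fun m => tadpoleSum x m 0) * P = mk fun m => m * pathSum x (m + 1) := by
      ext m
      rw [coeff_mul, Finset.Nat.sum_antidiagonal_eq_sum_range_succ_mk, Finset.sum_range_succ]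
      simp only [coeff_mk, hP, Nat.sub_self, pathSum, mul_one]
      rw [tadpoleSum_eq_sum x m 0]
      simp [pathSum]
    rw [hT, mul_assoc, h2]
    ext m
    cases m with
    | zero => simp [hP, pathSum]
    | succ m =>
      simp only [coeff_succ_X_mul, map_add, map_sub, coeff_derivative, coeff_mk, hP, coeff_one]
      simp; ring
  have h2 : d⁄dX R (subXDeriv E) = - (X * d⁄dX R (d⁄dX R E)) := by
    simp [subXDeriv, Derivation.leibniz]
  have h3 : d⁄dX R P * subXDeriv E - P * (X * d⁄dX R (d⁄dX R E)) = d⁄dX R E := by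
    have := congrArg (d⁄dX R) hPG
    rw [Derivation.leibniz, h2, smul_eq_mul, smul_eq_mul] at this
    linear_combination this
  have hu : IsUnit E := isUnit_of_constantCoeff_eq_one (constantCoeff_elemSeries x _)
  have h4 : T * subXDeriv E = X ^ 2 * d⁄dX R (d⁄dX R E) := by
    refine hu.mul_left_cancel ?_
    have h5 : T * E = X ^ 2 * (d⁄dX R (d⁄dX R E)) * P := by
      have h6 : T * P * subXDeriv E = (X * d⁄dX R P - P + 1) * subXDeriv E := by rw [h1]
      rw [mul_assoc, hPG] at h6
      rw [h6]
      have h7 : subXDeriv E = E - X * d⁄dX R E := rfl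
      linear_combination X * h3 - hPG + h7
    calc E * (T * subXDeriv E) = T * E * subXDeriv E := by ring
      _ = X ^ 2 * (d⁄dX R (d⁄dX R E)) * (P * subXDeriv E) := by rw [h5]; ring
      _ = _ := by rw [hPG]; ring
  rw [cycleSeries, ← h4, mul_assoc, subXDeriv_mul_invSeries (constantCoeff_elemSeries x _), mul_one]

theorem tadpoleSum_eq_series (m j : ℕ) : tadpoleSum x m j =
    m * coeff (m + j + 1) (pathSeries (elemSeries x Finset.univ)) -
      ∑ r ∈ Finset.range m, coeff (r + 1) (cycleSeries (elemSeries x Finset.univ)) *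
        coeff (m + j - r) (pathSeries (elemSeries x Finset.univ)) := by
  rw [tadpoleSum_eq_sum, ← mk_pathSum, ← X_mul_mk_tadpoleSum]
  simp [coeff_succ_X_mul]

theorem rootedCycleSum_coeff_elemSeries (b d p : ℕ) :
    rootedCycleSum x b ((step x ^ d) fun k => coeff p (elemSeries x (Finset.univ.erase k))) =
      dumbbellSeries (elemSeries x Finset.univ) b d p := by
  have h : (fun k => coeff p (elemSeries x (Finset.univ.erase k))) =
      ∑ i ∈ Finset.range (p + 1), coeff i (subXDeriv (elemSeries x Finset.univ)) •
        walkSum x (p - i) := by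
    funext k
    rw [← subXDeriv_mul_mk_walkSum, coeff_mul, Finset.Nat.sum_antidiagonal_eq_sum_range_succ_mk]
    simp
  rw [h, map_sum, map_sum, dumbbellSeries]
  refine Finset.sum_congr rfl fun i hi => ?_
  have hi' : i ≤ p := by simpa [Nat.lt_succ_iff] using hi
  rw [map_smul, map_smul, step_pow_walkSum, smul_eq_mul, ← tadpoleSum, tadpoleSum_eq_series,
    ← Nat.add_sub_assoc hi']

end Elementary

end GeneratingFunctions

/-! ### Positivity of `dumbbellSeries` in a subsemiring containing the `e_i`. -/

section Positivity

open PowerSeries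

variable {R : Type*} [CommRing R]

/-- The terms of degree at most `b`. -/
noncomputable def headSeries (b : ℕ) (f : R⟦X⟧) : R⟦X⟧ :=
  mk fun r => if r ≤ b then coeff r f else 0

/-- The terms of degree at least `a`. -/
noncomputable def tailSeries (a : ℕ) (f : R⟦X⟧) : R⟦X⟧ :=
  mk fun r => if a ≤ r then coeff r f else 0

theorem coeff_headSeries (b r : ℕ) (f : R⟦X⟧) :
    coeff r (headSeries b f) = if r ≤ b then coeff r f else 0 := coeff_mk _ _

theorem coeff_tailSeries (a r : ℕ) (f : R⟦X⟧) :
    coeff r (tailSeries a f) = if a ≤ r then coeff r f else 0 := coeff_mk _ _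

/-- When `i + j = a + b`, the conditions `j ≤ b` and `a ≤ i` agree, so a truncation can change
factor. -/
theorem coeff_mul_headSeries (a b : ℕ) (f g : R⟦X⟧) :
    coeff (a + b) (f * headSeries b g) = coeff (a + b) (tailSeries a f * g) := by
  rw [coeff_mul, coeff_mul]
  refine Finset.sum_congr rfl fun ij hij => ?_
  rw [Finset.HasAntidiagonal.mem_antidiagonal] at hij
  rw [coeff_headSeries, coeff_tailSeries]
  by_cases h : a ≤ ij.1
  · rw [if_pos h, if_pos (by omega)]
  · rw [if_neg h, if_neg (by omega), mul_zero, zero_mul]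

theorem coeff_mul_mem {S : Subsemiring R} {f g : R⟦X⟧} {n : ℕ}
    (h : ∀ i j, i + j = n → coeff i f * coeff j g ∈ S) : coeff n (f * g) ∈ S := by
  rw [coeff_mul]
  exact S.sum_mem fun ij hij => h _ _ (Finset.HasAntidiagonal.mem_antidiagonal.1 hij)

theorem intCast_mul_mem {S : Subsemiring R} {z : ℤ} (hz : 0 ≤ z) {s : R} (hs : s ∈ S) :
    (z : R) * s ∈ S := by
  lift z to ℕ using hz
  rw [Int.cast_natCast]
  exact S.mul_mem (natCast_mem S z) hs

theorem sum_sum_mem_of_symmetrized {ι : Type*} [DecidableEq ι] {S : Subsemiring R} (A : Finset ι)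
    (w : ι → ι → R) (h1 : ∀ i, w i i ∈ S) (h2 : ∀ i j, i ≠ j → w i j + w j i ∈ S) :
    ∑ i ∈ A, ∑ j ∈ A, w i j ∈ S := by
  induction A using Finset.induction_on with
  | empty => simp
  | insert a A ha ih =>
    have h : ∑ i ∈ insert a A, ∑ j ∈ insert a A, w i j =
        w a a + ∑ j ∈ A, (w a j + w j a) + ∑ i ∈ A, ∑ j ∈ A, w i j := by
      simp only [Finset.sum_insert ha, Finset.sum_add_distrib]
      ring
    rw [h]
    refine S.add_mem (S.add_mem (h1 a) (S.sum_mem fun j hj => h2 a j ?_)) ih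
    rintro rfl
    exact ha hj

theorem symmetrized_coefficient_nonneg {a i j : ℤ} (hi : 1 ≤ i) (hai : a ≤ i) (hij : i ≤ j) :
    0 ≤ j * ((i - 1) * (i - a + 1) - (j - 1)) + i * ((j - 1) * (j - a + 1) - (i - 1)) := by
  have h1 : 0 ≤ j * ((i - 1) * (i - a)) := by
    apply mul_nonneg (by omega) (mul_nonneg (by omega) (by omega))
  have h2 : 0 ≤ i * ((j - 1) * (i - a)) := by
    apply mul_nonneg (by omega) (mul_nonneg (by omega) (by omega))
  have h3 : 0 ≤ (i - 1) * (j * (j - i)) := by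
    apply mul_nonneg (by omega) (mul_nonneg (by omega) (by omega))
  -- The expression is exactly the sum of the three products above.
  nlinarith

/-- For `E = ∑ e_i X^i`, the series `∑ (i - 1) e_i X^i` without constant term. -/
noncomputable def xDerivSub (E : R⟦X⟧) : R⟦X⟧ := mk fun i => ((i - 1 : ℕ) : R) * coeff i E

variable {E : R⟦X⟧} {S : Subsemiring R}

theorem coeff_xDerivSub_zero : coeff 0 (xDerivSub E) = 0 := by simp [xDerivSub]

theorem coeff_xDerivSub (i : ℕ) (hi : 1 ≤ i) :
    coeff i (xDerivSub E) = ((i : R) - 1) * coeff i E := by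
  rw [xDerivSub, coeff_mk, Nat.cast_sub hi, Nat.cast_one]

theorem subXDeriv_eq (hE : constantCoeff E = 1) : subXDeriv E = 1 - xDerivSub E := by
  ext i
  rw [coeff_subXDeriv, map_sub, coeff_one]
  rcases Nat.eq_zero_or_pos i with rfl | hi
  · simp [coeff_xDerivSub_zero, hE]
  · rw [coeff_xDerivSub i hi, if_neg hi.ne']; ring

theorem invSeries_eq (hE : constantCoeff E = 1) :
    invSeries E = 1 + xDerivSub E * invSeries E := by
  have := subXDeriv_mul_invSeries hE
  rw [subXDeriv_eq hE] at this
  linear_combination this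

theorem pathSeries_eq (hE : constantCoeff E = 1) :
    pathSeries E = 1 + X * d⁄dX R E * invSeries E := by
  have := subXDeriv_mul_invSeries hE
  rw [subXDeriv] at this
  rw [pathSeries]
  linear_combination this

theorem cycleSeries_eq (hE : constantCoeff E = 1) :
    cycleSeries E = X * d⁄dX R (xDerivSub E) + xDerivSub E * cycleSeries E := by
  have h1 : xDerivSub E = 1 - subXDeriv E := by rw [subXDeriv_eq hE]; ring
  have h2 : d⁄dX R (xDerivSub E) = X * d⁄dX R (d⁄dX R E) := by
    rw [h1]; simp [subXDeriv, Derivation.leibniz]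
  have h3 := invSeries_eq hE
  rw [h2, cycleSeries]
  linear_combination (X ^ 2 * d⁄dX R (d⁄dX R E)) * h3

/-- Differentiate `P (E - X E') = E` and use `(E - X E')' = -X E''`. -/
theorem cycleSeries_mul_pathSeries (hE : constantCoeff E = 1) :
    cycleSeries E * pathSeries E = X * d⁄dX R (pathSeries E) - pathSeries E + 1 := by
  have hGH := subXDeriv_mul_invSeries hE
  have h1 : pathSeries E * subXDeriv E = E := by
    rw [pathSeries]; linear_combination E * hGH
  have h2 : d⁄dX R (subXDeriv E) = - (X * d⁄dX R (d⁄dX R E)) := by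
    simp [subXDeriv, Derivation.leibniz]
  have h3 := congrArg (d⁄dX R) h1
  rw [Derivation.leibniz, h2, smul_eq_mul, smul_eq_mul] at h3
  have hu : IsUnit (subXDeriv E) := IsUnit.of_mul_eq_one _ hGH
  refine hu.mul_left_cancel ?_
  have h4 : subXDeriv E * cycleSeries E = X ^ 2 * d⁄dX R (d⁄dX R E) := by
    rw [cycleSeries]; linear_combination (X ^ 2 * d⁄dX R (d⁄dX R E)) * hGH
  have h5 : subXDeriv E = E - X * d⁄dX R E := rfl
  linear_combination pathSeries E * h4 - X * h3 + h1 - h5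

theorem coeff_zero_cycleSeries : coeff 0 (cycleSeries E) = 0 := by
  simp [cycleSeries]

theorem coeff_X_mul_derivative (f : R⟦X⟧) (n : ℕ) : coeff n (X * d⁄dX R f) = n * coeff n f := by
  cases n with
  | zero => simp
  | succ n => rw [coeff_succ_X_mul, coeff_derivative]; push_cast; ring

theorem coeff_X_sq_mul_derivative (f : R⟦X⟧) (n : ℕ) :
    coeff n (X ^ 2 * d⁄dX R (d⁄dX R f)) = n * (n - 1) * coeff n f := by
  rcases n with _ | _ | n
  · simp
  · rw [pow_two, mul_assoc]; simp
  · rw [pow_two, mul_assoc, coeff_succ_X_mul, coeff_succ_X_mul, coeff_derivative, coeff_derivative]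
    push_cast; ring

/-- Truncation at degree `b` of the recursion `C = X F' + F C`. -/
theorem headSeries_cycleSeries (hE : constantCoeff E = 1) (b : ℕ) :
    headSeries b (cycleSeries E) = ∑ i ∈ Finset.range (b + 1),
      C (coeff i (xDerivSub E)) * (X ^ i * (C (i : R) + headSeries (b - i) (cycleSeries E))) := by
  ext r
  rw [coeff_headSeries, map_sum]
  have hterm : ∀ i ∈ Finset.range (b + 1), coeff r (C (coeff i (xDerivSub E)) * (X ^ i *
      (C (i : R) + headSeries (b - i) (cycleSeries E)))) = if i ≤ r ∧ r ≤ b then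
        coeff i (xDerivSub E) * ((if r = i then (i : R) else 0) + coeff (r - i) (cycleSeries E))
        else 0 := by
    intro i hi
    have hi' : i ≤ b := by simpa [Nat.lt_succ_iff] using hi
    rw [coeff_C_mul, coeff_X_pow_mul', map_add, coeff_C, coeff_headSeries]
    by_cases h1 : i ≤ r
    · by_cases h2 : r ≤ b
      · have h3 : r - i = 0 ↔ r = i := by omega
        rw [if_pos h1, if_pos (And.intro h1 h2), if_pos (by omega : r - i ≤ b - i)]
        simp only [h3]
      · have h3 : ¬ r - i = 0 := by omega
        have h4 : ¬ r - i ≤ b - i := by omega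
        simp [h1, h2, h3, h4]
    · simp [h1]
  rw [Finset.sum_congr rfl hterm]
  by_cases hr : r ≤ b
  · rw [if_pos hr]
    simp only [hr, and_true]
    rw [← Finset.sum_filter]
    have hf : (Finset.range (b + 1)).filter (fun i => i ≤ r) = Finset.range (r + 1) := by
      ext i; simp only [Finset.mem_filter, Finset.mem_range]; omega
    rw [hf]
    simp only [mul_add, Finset.sum_add_distrib]
    conv_lhs => rw [cycleSeries_eq hE]
    rw [map_add, coeff_X_mul_derivative, coeff_mul,
      Finset.Nat.sum_antidiagonal_eq_sum_range_succ_mk]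
    congr 1
    simp [mul_comm]
  · simp [hr]

theorem coeff_invSeries_mem (hE : constantCoeff E = 1) (hS : ∀ i, coeff i E ∈ S) (K : ℕ) :
    coeff K (invSeries E) ∈ S := by
  induction K using Nat.strong_induction_on with
  | _ K ih =>
    rw [invSeries_eq hE, map_add]
    refine S.add_mem ?_ (coeff_mul_mem fun i j hij => ?_)
    · rw [coeff_one]; split_ifs
      exacts [S.one_mem, S.zero_mem]
    · rcases Nat.eq_zero_or_pos i with rfl | hi
      · rw [coeff_xDerivSub_zero, zero_mul]; exact S.zero_mem
      · refine S.mul_mem ?_ (ih j (by omega))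
        rw [xDerivSub, coeff_mk]
        exact S.mul_mem (natCast_mem S _) (hS i)

theorem coeff_xDerivSub_mem (hS : ∀ i, coeff i E ∈ S) (i : ℕ) : coeff i (xDerivSub E) ∈ S := by
  rw [xDerivSub, coeff_mk]
  exact S.mul_mem (natCast_mem S _) (hS i)

/-- A subtraction-free recursion: the `i` in `headSeries_cycleSeries` turns `b` into `b - i ≥ 0`,
and the terms of `F` beyond degree `b` keep the factor `b`. -/
theorem sub_headSeries_mul_invSeries (hE : constantCoeff E = 1) (b : ℕ) :
    (C (b : R) - headSeries b (cycleSeries E)) * invSeries E = C (b : R) +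
      ∑ i ∈ Finset.range (b + 1), C (coeff i (xDerivSub E)) * (X ^ i *
        ((C ((b - i : ℕ) : R) - headSeries (b - i) (cycleSeries E)) * invSeries E)) +
      C (b : R) * (tailSeries (b + 1) (xDerivSub E) * invSeries E) := by
  have h1 : xDerivSub E = ∑ i ∈ Finset.range (b + 1), C (coeff i (xDerivSub E)) * X ^ i +
      tailSeries (b + 1) (xDerivSub E) := by
    ext r
    rw [map_add, map_sum, coeff_tailSeries]
    simp only [coeff_C_mul, coeff_X_pow, mul_ite, mul_one, mul_zero, Finset.sum_ite_eq,
      Finset.mem_range]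
    by_cases h : r < b + 1
    · rw [if_pos h, if_neg (by omega), add_zero]
    · rw [if_neg h, if_pos (by omega), zero_add]
  have h2 : ∑ i ∈ Finset.range (b + 1), C (coeff i (xDerivSub E)) * (X ^ i *
        ((C ((b - i : ℕ) : R) - headSeries (b - i) (cycleSeries E)) * invSeries E)) =
      (C (b : R) * (∑ i ∈ Finset.range (b + 1), C (coeff i (xDerivSub E)) * X ^ i) -
        headSeries b (cycleSeries E)) * invSeries E := by
    rw [headSeries_cycleSeries hE b, Finset.mul_sum, ← Finset.sum_sub_distrib, Finset.sum_mul]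
    refine Finset.sum_congr rfl fun i hi => ?_
    rw [Nat.cast_sub (by simpa [Nat.lt_succ_iff] using hi), map_sub]
    ring
  rw [h2]
  have h3 := invSeries_eq hE
  linear_combination C (b : R) * h3 + C (b : R) * invSeries E * h1

theorem coeff_sub_headSeries_mul_invSeries_mem (hE : constantCoeff E = 1)
    (hS : ∀ i, coeff i E ∈ S) (K b : ℕ) :
    coeff K ((C (b : R) - headSeries b (cycleSeries E)) * invSeries E) ∈ S := by
  induction K using Nat.strong_induction_on generalizing b with
  | _ K ih =>
    rw [sub_headSeries_mul_invSeries hE, map_add, map_add, map_sum]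
    refine S.add_mem (S.add_mem ?_ (S.sum_mem fun i _ => ?_)) ?_
    · rw [coeff_C]; split_ifs
      exacts [natCast_mem S b, S.zero_mem]
    · rw [coeff_C_mul, coeff_X_pow_mul']
      -- `F` has no constant term, so every surviving summand has smaller degree.
      rcases Nat.eq_zero_or_pos i with rfl | hi
      · rw [coeff_xDerivSub_zero, zero_mul]; exact S.zero_mem
      · split_ifs with h
        · exact S.mul_mem (coeff_xDerivSub_mem hS i) (ih _ (by omega) _)
        · rw [mul_zero]; exact S.zero_mem
    · rw [coeff_C_mul]
      refine S.mul_mem (natCast_mem S b) (coeff_mul_mem fun i j _ => ?_)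
      refine S.mul_mem ?_ (coeff_invSeries_mem hE hS j)
      rw [coeff_tailSeries]; split_ifs
      exacts [coeff_xDerivSub_mem hS i, S.zero_mem]

/-- The `e`-positivity of a cycle with a tail. -/
theorem coeff_sub_headSeries_mul_pathSeries_mem (hE : constantCoeff E = 1)
    (hS : ∀ i, coeff i E ∈ S) {M b : ℕ} (hM : b < M) :
    coeff M ((C (b : R) - headSeries b (cycleSeries E)) * pathSeries E) ∈ S := by
  have h : (C (b : R) - headSeries b (cycleSeries E)) * pathSeries E =
      (C (b : R) - headSeries b (cycleSeries E)) +
        X * d⁄dX R E * ((C (b : R) - headSeries b (cycleSeries E)) * invSeries E) := by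
    rw [pathSeries_eq hE]; ring
  -- As `M > b`, the first summand, of degree at most `b`, contributes nothing.
  rw [h, map_add, map_sub, coeff_C, if_neg (by omega), coeff_headSeries, if_neg (by omega),
    sub_zero, zero_add]
  refine coeff_mul_mem fun i j _ => ?_
  rw [coeff_X_mul_derivative]
  exact S.mul_mem (S.mul_mem (natCast_mem S i) (hS i))
    (coeff_sub_headSeries_mul_invSeries_mem hE hS j b)

theorem dumbbellSeries_eq (b d p : ℕ) : dumbbellSeries E b d p =
    ∑ i ∈ Finset.range (p + 1), coeff i (subXDeriv E) * coeff (d + p + 1 + b - i)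
      ((C (b : R) - headSeries b (cycleSeries E)) * pathSeries E) := by
  refine Finset.sum_congr rfl fun i hi => ?_
  have hi' : i ≤ p := by simpa [Nat.lt_succ_iff] using hi
  have hM : d + p + 1 + b - i = b + (d + p - i) + 1 := by omega
  rw [hM, sub_mul, map_sub, coeff_C_mul]
  congr 2
  rw [coeff_mul, Finset.Nat.sum_antidiagonal_eq_sum_range_succ_mk]
  simp only [coeff_headSeries, ite_mul, zero_mul]
  rw [← Finset.sum_filter]
  have hf : (Finset.range (b + (d + p - i) + 1).succ).filter (fun r => r ≤ b) =
      Finset.range (b + 1) := by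
    ext r; simp only [Finset.mem_filter, Finset.mem_range]; omega
  rw [hf, Finset.sum_range_succ', coeff_zero_cycleSeries, zero_mul, add_zero]
  refine Finset.sum_congr rfl fun r _ => ?_
  rw [Nat.add_sub_add_right]

/-- The part of `dumbbellSeries` that is not a combination of cycles with tails. -/
theorem coeff_head_mul_eq (hE : constantCoeff E = 1) (a b : ℕ) :
    coeff (a + 1 + b) (headSeries a (subXDeriv E) *
      ((C (b : R) - headSeries b (cycleSeries E)) * pathSeries E)) =
    coeff (a + 1 + b) (C (b : R) * E + tailSeries (a + 1) (xDerivSub E) *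
      (C (b : R) * pathSeries E - X * d⁄dX R (pathSeries E) + pathSeries E - 1) -
      tailSeries (a + 1) E * cycleSeries E) := by
  have h1 : headSeries a (subXDeriv E) = subXDeriv E + tailSeries (a + 1) (xDerivSub E) := by
    ext r
    rw [map_add, coeff_headSeries, coeff_tailSeries, subXDeriv_eq hE, map_sub, coeff_one]
    by_cases h : r ≤ a
    · rw [if_pos h, if_neg (by omega : ¬ a + 1 ≤ r), add_zero]
    · rw [if_neg h, if_pos (by omega : a + 1 ≤ r), if_neg (by omega)]; ring
  have h2 : subXDeriv E * pathSeries E = E := by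
    rw [pathSeries]; linear_combination E * subXDeriv_mul_invSeries hE
  -- This product already starts in degree `a + 1`, so moving the truncation off `C` onto it costs
  -- nothing, and `C P` can be rewritten.
  have h3 : tailSeries (a + 1) (tailSeries (a + 1) (xDerivSub E) * pathSeries E) =
      tailSeries (a + 1) (xDerivSub E) * pathSeries E := by
    ext r
    rw [coeff_tailSeries, ite_eq_left_iff]
    intro hr
    rw [coeff_mul]
    refine (Finset.sum_eq_zero fun ij hij => ?_).symm
    rw [Finset.HasAntidiagonal.mem_antidiagonal] at hij
    rw [coeff_tailSeries, if_neg (by omega), zero_mul]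
  have h4 : headSeries a (subXDeriv E) *
      ((C (b : R) - headSeries b (cycleSeries E)) * pathSeries E) =
      C (b : R) * E + C (b : R) * (tailSeries (a + 1) (xDerivSub E) * pathSeries E) -
      E * headSeries b (cycleSeries E) -
      tailSeries (a + 1) (xDerivSub E) * pathSeries E * headSeries b (cycleSeries E) := by
    rw [h1]; linear_combination (C (b : R) - headSeries b (cycleSeries E)) * h2
  have h5 := cycleSeries_mul_pathSeries hE
  rw [h4, map_sub, map_sub, coeff_mul_headSeries, coeff_mul_headSeries, h3, ← map_sub, ← map_sub]
  congr 1
  linear_combination -tailSeries (a + 1) (xDerivSub E) * h5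

/-- Expand `P = 1 + X E' / (1 - F)` and `C = X² E'' / (1 - F)`: the factor `j` comes from `X E'`,
the subtracted `j (j - 1)` from `X² E''`. -/
theorem coeff_head_mul_eq_sum (hE : constantCoeff E = 1) (a b : ℕ) :
    coeff (a + 1 + b) (headSeries a (subXDeriv E) *
      ((C (b : R) - headSeries b (cycleSeries E)) * pathSeries E)) =
    (b * (a + 1 + b) : ℕ) * coeff (a + 1 + b) E +
    ∑ i ∈ Finset.range (a + 1 + b + 1), ∑ j ∈ Finset.range (a + 1 + b + 1),
      if a + 1 ≤ i ∧ i + j ≤ a + 1 + b then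
        ((j * ((i - 1) * (i - (a + 1) + 1) - (j - 1)) : ℤ) : R) *
          (coeff i E * coeff j E * coeff (a + 1 + b - i - j) (invSeries E)) else 0 := by
  have hP : ∀ M, coeff M (pathSeries E) = (if M = 0 then 1 else 0) +
      ∑ j ∈ Finset.range (M + 1), (j * coeff j E) * coeff (M - j) (invSeries E) := by
    intro M
    rw [pathSeries_eq hE, map_add, coeff_one, coeff_mul,
      Finset.Nat.sum_antidiagonal_eq_sum_range_succ_mk]
    simp only [coeff_X_mul_derivative]
  have hC : ∀ M, coeff M (cycleSeries E) =
      ∑ j ∈ Finset.range (M + 1), (j * (j - 1) * coeff j E) * coeff (M - j) (invSeries E) := by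
    intro M
    rw [cycleSeries, coeff_mul, Finset.Nat.sum_antidiagonal_eq_sum_range_succ_mk]
    simp only [coeff_X_sq_mul_derivative]
  have hterm : ∀ i ∈ Finset.range (a + 1 + b + 1),
      coeff i (tailSeries (a + 1) (xDerivSub E)) * coeff (a + 1 + b - i)
        (C (b : R) * pathSeries E - X * d⁄dX R (pathSeries E) + pathSeries E - 1) -
      coeff i (tailSeries (a + 1) E) * coeff (a + 1 + b - i) (cycleSeries E) =
      -- Contribution of the constant term of `P`, present only in the top degree, where `i - 1 = a
      -- + b`. Adding `b e_i` from `b E` gives `b (a + 1 + b) e_i`.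
      (if i = a + 1 + b then (b * (a + b) : R) * coeff i E else 0) +
      ∑ j ∈ Finset.range (a + 1 + b + 1),
      if a + 1 ≤ i ∧ i + j ≤ a + 1 + b then
        ((j * ((i - 1) * (i - (a + 1) + 1) - (j - 1)) : ℤ) : R) *
          (coeff i E * coeff j E * coeff (a + 1 + b - i - j) (invSeries E)) else 0 := by
    intro i hi
    rw [Finset.mem_range] at hi
    by_cases hai : a + 1 ≤ i
    · obtain ⟨M, hM⟩ : ∃ M, a + 1 + b = i + M := ⟨a + 1 + b - i, by omega⟩
      have hM' : a + 1 + b - i = M := by omega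
      have hMR : (a : R) + 1 + b = i + M := by exact_mod_cast congrArg (Nat.cast (R := R)) hM
      have hs : ∀ f : ℕ → R, (∑ j ∈ Finset.range (a + 1 + b + 1),
          if a + 1 ≤ i ∧ i + j ≤ a + 1 + b then f j else 0) =
          ∑ j ∈ Finset.range (M + 1), f j := by
        intro f
        rw [← Finset.sum_filter]
        congr 1
        ext j; simp only [Finset.mem_filter, Finset.mem_range]; omega
      rw [hs, hM', coeff_tailSeries, coeff_tailSeries, if_pos hai, if_pos hai,
        coeff_xDerivSub i (by omega), map_sub, map_add, map_sub, coeff_C_mul,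
        coeff_X_mul_derivative, hC, hP, coeff_one]
      have h0 : (i = a + 1 + b) ↔ M = 0 := by omega
      simp only [h0]
      have hsum : ∑ j ∈ Finset.range (M + 1),
          ((j * ((i - 1) * (i - (a + 1) + 1) - (j - 1)) : ℤ) : R) *
          (coeff i E * coeff j E * coeff (M - j) (invSeries E)) =
          ((i : R) - 1) * coeff i E * (b + 1 - M) *
            (∑ j ∈ Finset.range (M + 1), (j * coeff j E) * coeff (M - j) (invSeries E)) -
          coeff i E * ∑ j ∈ Finset.range (M + 1),
            (j * (j - 1) * coeff j E) * coeff (M - j) (invSeries E) := by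
        rw [Finset.mul_sum, Finset.mul_sum, ← Finset.sum_sub_distrib]
        refine Finset.sum_congr rfl fun j _ => ?_
        have : (b : R) + 1 - M = i - (a + 1) + 1 := by linear_combination hMR
        rw [this]
        push_cast
        ring
      rw [hsum]
      split_ifs with hM0
      · subst hM0
        have : (i : R) - 1 = a + b := by push_cast at hMR; linear_combination -hMR
        rw [this]
        push_cast; ring
      · ring
    · have h1 : i ≠ a + 1 + b := by omega
      simp [coeff_tailSeries, hai, h1]
  rw [coeff_head_mul_eq hE, map_sub, map_add, coeff_C_mul, coeff_mul, coeff_mul,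
    Finset.Nat.sum_antidiagonal_eq_sum_range_succ_mk,
    Finset.Nat.sum_antidiagonal_eq_sum_range_succ_mk, add_sub_assoc, ← Finset.sum_sub_distrib,
    Finset.sum_congr rfl hterm, Finset.sum_add_distrib, ← add_assoc]
  congr 1
  rw [Finset.sum_ite_eq' , if_pos (Finset.mem_range.2 (Nat.lt_succ_self _))]
  push_cast; ring

theorem coeff_head_mul_mem (hE : constantCoeff E = 1) (hS : ∀ i, coeff i E ∈ S) (a b : ℕ) :
    coeff (a + 1 + b) (headSeries a (subXDeriv E) *
      ((C (b : R) - headSeries b (cycleSeries E)) * pathSeries E)) ∈ S := by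
  rw [coeff_head_mul_eq_sum hE]
  refine S.add_mem (S.mul_mem (natCast_mem S _) (hS _)) ?_
  have hprod : ∀ i j k, coeff i E * coeff j E * coeff k (invSeries E) ∈ S := fun i j k =>
    S.mul_mem (S.mul_mem (hS i) (hS j)) (coeff_invSeries_mem hE hS k)
  -- These weights need no partner. This covers the diagonal and the pairs whose smaller index is at
  -- most `a`, where the swapped term is absent.
  have hlt : ∀ i j : ℕ, a + 1 ≤ i → j ≤ i →
      0 ≤ (j * ((i - 1) * (i - (a + 1) + 1) - (j - 1)) : ℤ) := by
    intro i j hi hj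
    refine mul_nonneg (by omega) ?_
    have h1 : 0 ≤ ((i : ℤ) - 1) * (i - (a + 1)) := mul_nonneg (by omega) (by omega)
    have h2 : (j : ℤ) ≤ i := by exact_mod_cast hj
    linarith
  refine sum_sum_mem_of_symmetrized _ _ (fun i => ?_) ?_
  · split_ifs with h
    · exact intCast_mul_mem (hlt i i h.1 le_rfl) (hprod _ _ _)
    · exact S.zero_mem
  · have main : ∀ i j : ℕ, i ≤ j →
        ((if a + 1 ≤ i ∧ i + j ≤ a + 1 + b then
          ((j * ((i - 1) * (i - (a + 1) + 1) - (j - 1)) : ℤ) : R) *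
          (coeff i E * coeff j E * coeff (a + 1 + b - i - j) (invSeries E)) else 0) +
        (if a + 1 ≤ j ∧ j + i ≤ a + 1 + b then
          ((i * ((j - 1) * (j - (a + 1) + 1) - (i - 1)) : ℤ) : R) *
          (coeff j E * coeff i E * coeff (a + 1 + b - j - i) (invSeries E)) else 0)) ∈ S := by
      intro i j hij
      by_cases hi : a + 1 ≤ i
      · by_cases hN : i + j ≤ a + 1 + b
        · rw [if_pos ⟨hi, hN⟩, if_pos ⟨by omega, by omega⟩, mul_comm (coeff j E),
            Nat.sub_right_comm (a + 1 + b) j i, ← add_mul, ← Int.cast_add]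
          exact intCast_mul_mem (symmetrized_coefficient_nonneg (by omega) (by omega) (by omega))
            (hprod _ _ _)
        · rw [if_neg (by omega), if_neg (by omega), add_zero]; exact S.zero_mem
      · rw [if_neg (fun h => hi h.1), zero_add]
        split_ifs with h
        · exact intCast_mul_mem (hlt j i h.1 hij) (hprod _ _ _)
        · exact S.zero_mem
    intro i j _
    rcases le_total i j with h | h
    · exact main i j h
    · rw [add_comm]; exact main j i h

theorem dumbbellSeries_mem (hE : constantCoeff E = 1) (hS : ∀ i, coeff i E ∈ S) (b d p : ℕ) :
    dumbbellSeries E b d p ∈ S := by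
  set T := (C (b : R) - headSeries b (cycleSeries E)) * pathSeries E with hT
  have h1 : coeff (d + p + 1 + b) (headSeries (d + p) (subXDeriv E) * T) =
      ∑ i ∈ Finset.range (d + p + 1), coeff i (subXDeriv E) * coeff (d + p + 1 + b - i) T := by
    rw [coeff_mul, Finset.Nat.sum_antidiagonal_eq_sum_range_succ_mk]
    simp only [coeff_headSeries, ite_mul, zero_mul]
    rw [← Finset.sum_filter]
    congr 1
    ext i; simp only [Finset.mem_filter, Finset.mem_range]; omega
  -- Summing up to `d + p` instead of `p` makes the truncation in `i` complementary to that of `C`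
  -- at `b`; the terms overcounted have coefficient `-F_i` and are added back.
  have h2 : dumbbellSeries E b d p =
      coeff (d + p + 1 + b) (headSeries (d + p) (subXDeriv E) * T) +
      ∑ i ∈ Finset.Ico (p + 1) (d + p + 1),
        coeff i (xDerivSub E) * coeff (d + p + 1 + b - i) T := by
    rw [h1, dumbbellSeries_eq, ← hT,
      ← Finset.sum_range_add_sum_Ico _ (by omega : p + 1 ≤ d + p + 1), add_assoc (Finset.sum _ _),
      ← Finset.sum_add_distrib, left_eq_add]
    refine Finset.sum_eq_zero fun i hi => ?_
    have hi' : ¬ i = 0 := by rw [Finset.mem_Ico] at hi; omega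
    rw [subXDeriv_eq hE, map_sub, coeff_one, if_neg hi']
    ring
  rw [h2]
  refine S.add_mem (coeff_head_mul_mem hE hS _ _) (S.sum_mem fun i hi => ?_)
  rw [Finset.mem_Ico] at hi
  exact S.mul_mem (coeff_xDerivSub_mem hS i)
    (coeff_sub_headSeries_mul_pathSeries_mem hE hS (by omega))

end Positivity

/-! ### Colourings of the dumbbell as walks followed by injective colourings. -/

section Walks

variable {K R : Type*} [Fintype K] [DecidableEq K] [CommRing R]

/-- Consecutive colours differ. -/
def IsProperWalk {K : Type*} {j : ℕ} (u : Fin (j + 1) → K) : Prop :=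
  ∀ i : Fin j, u i.castSucc ≠ u i.succ

instance {j : ℕ} : DecidablePred (IsProperWalk (K := K) (j := j)) := fun _ =>
  inferInstanceAs (Decidable (∀ _, _))

theorem isProperWalk_snoc {K : Type*} {j : ℕ} (u : Fin (j + 1) → K) (c : K) :
    IsProperWalk (Fin.snoc u c : Fin (j + 2) → K) ↔ IsProperWalk u ∧ u (Fin.last j) ≠ c := by
  unfold IsProperWalk
  rw [Fin.forall_fin_succ']
  refine and_congr (forall_congr' fun i => ?_) ?_
  · rw [Fin.succ_castSucc, Fin.snoc_castSucc, Fin.snoc_castSucc]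
  · rw [Fin.succ_last, Fin.snoc_castSucc, Fin.snoc_last]

/-- Summing out the last colour of a proper walk is one application of `step`. -/
theorem sum_isProperWalk_succ (x : K → R) (j : ℕ) (Ψ : (Fin (j + 1) → K) → K → R) :
    (∑ u : Fin (j + 2) → K, if IsProperWalk u then
      (∏ i, x (u i)) * Ψ (Fin.init u) (u (Fin.last _)) else 0) =
    ∑ u : Fin (j + 1) → K, if IsProperWalk u then
      (∏ i, x (u i)) * step x (Ψ u) (u (Fin.last _)) else 0 := by
  rw [← (Fin.snocEquiv fun _ : Fin (j + 2) => K).sum_comp, Fintype.sum_prod_type_right]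
  refine Finset.sum_congr rfl fun u _ => ?_
  have h : ∀ c : K, (Fin.snocEquiv fun _ : Fin (j + 2) => K) (c, u) =
      (Fin.snoc u c : Fin (j + 2) → K) := fun _ => rfl
  simp only [h, isProperWalk_snoc, Fin.prod_univ_castSucc (n := j + 1), Fin.snoc_castSucc,
    Fin.snoc_last, Fin.init_snoc]
  by_cases hu : IsProperWalk u
  · simp only [hu, true_and, if_true]
    rw [step_apply_eq_sum_ite, Finset.mul_sum]
    refine Finset.sum_congr rfl fun c _ => ?_
    split_ifs <;> ring
  · simp [hu]

theorem sum_isProperWalk (x : K → R) (j : ℕ) (Φ : K → K → R) :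
    (∑ u : Fin (j + 1) → K, if IsProperWalk u then
      (∏ i, x (u i)) * Φ (u 0) (u (Fin.last _)) else 0) =
    ∑ k, x k * (step x ^ j) (Φ k) k := by
  induction j generalizing Φ with
  | zero =>
    rw [← (Equiv.funUnique (Fin 1) K).symm.sum_comp]
    refine Finset.sum_congr rfl fun k _ => ?_
    simp [IsProperWalk]
  | succ j ih =>
    have := sum_isProperWalk_succ x j fun u => Φ (u 0)
    simp only [Fin.init, Fin.castSucc_zero] at this
    rw [this, ih fun k => step x (Φ k)]
    simp only [pow_succ, Module.End.mul_apply]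

theorem sum_isProperWalk_tadpole (x : K → R) (b d : ℕ) (g : K → R) :
    (∑ u : Fin (b + d + 1) → K,
      if IsProperWalk u ∧ u 0 ≠ u ⟨b, by omega⟩ then
        (∏ i, x (u i)) * g (u (Fin.last _)) else 0) =
    rootedCycleSum x b ((step x ^ d) g) := by
  induction d generalizing g with
  | zero =>
    rw [rootedCycleSum_apply, pow_zero, Module.End.one_apply,
      ← sum_isProperWalk x b fun k c => if k ≠ c then g c else 0]
    refine Finset.sum_congr rfl fun u _ => ?_
    have : (⟨b, by omega⟩ : Fin (b + 0 + 1)) = Fin.last b := rfl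
    rw [this, ite_and]
    split_ifs <;> simp_all
  | succ d ih =>
    have := sum_isProperWalk_succ x (b + d)
      fun u c => if u 0 ≠ u ⟨b, by omega⟩ then g c else 0
    simp only [Fin.init, Fin.castSucc_zero, Fin.castSucc_mk] at this
    rw [pow_succ, Module.End.mul_apply, ← ih]
    refine Eq.trans (Finset.sum_congr rfl fun u _ => ?_)
      (this.trans (Finset.sum_congr rfl fun u _ => ?_))
    · rw [ite_and]
      split_ifs <;> simp_all
      rfl
    · rw [ite_and]
      split_ifs with h1 h2
      · rfl
      · have : (fun _ => (0 : R)) = (0 : K → R) := rfl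
        rw [this, map_zero, Pi.zero_apply, mul_zero]
      · rfl

/-- The sum of the weights of the injective colourings with colours in `A`. -/
theorem sum_injective (x : K → R) (p : ℕ) (A : Finset K) :
    (∑ c : Fin p → K, if Function.Injective c ∧ ∀ i, c i ∈ A then ∏ i, x (c i) else 0) =
      (p.factorial : R) * PowerSeries.coeff p (elemSeries x A) := by
  induction p generalizing A with
  | zero =>
    rw [PowerSeries.coeff_zero_eq_constantCoeff_apply, constantCoeff_elemSeries]
    simp [Function.injective_of_subsingleton]
  | succ p ih =>
    -- Choosing the first colour corresponds to differentiating the generating function.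
    have h1 : ((p + 1).factorial : R) * PowerSeries.coeff (p + 1) (elemSeries x A) =
        p.factorial * PowerSeries.coeff p (PowerSeries.derivative R (elemSeries x A)) := by
      rw [PowerSeries.coeff_derivative, Nat.factorial_succ]; push_cast; ring
    rw [h1, derivative_elemSeries, map_sum, Finset.mul_sum,
      ← (Fin.consEquiv fun _ : Fin (p + 1) => K).sum_comp, Fintype.sum_prod_type,
      ← Finset.sum_subset (Finset.subset_univ A)]
    · refine Finset.sum_congr rfl fun k hk => ?_
      rw [PowerSeries.coeff_C_mul, mul_left_comm, ← ih, Finset.mul_sum]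
      refine Finset.sum_congr rfl fun c _ => ?_
      have h : (Fin.consEquiv fun _ : Fin (p + 1) => K) (k, c) =
        (Fin.cons k c : Fin (p + 1) → K) := rfl
      have hiff : (Function.Injective (Fin.cons k c : Fin (p + 1) → K) ∧
          ∀ i, (Fin.cons k c : Fin (p + 1) → K) i ∈ A) ↔
          (Function.Injective c ∧ ∀ i, c i ∈ A.erase k) := by
        rw [Fin.cons_injective_iff, Fin.forall_fin_succ]
        simp only [Fin.cons_zero, Fin.cons_succ, Finset.mem_erase, Set.mem_range, not_exists]
        constructor
        · rintro ⟨⟨h1, h2⟩, h3, h4⟩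
          exact ⟨h2, fun i => ⟨h1 i, h4 i⟩⟩
        · rintro ⟨h1, h2⟩
          exact ⟨⟨fun i => (h2 i).1, h1⟩, hk, fun i => (h2 i).2⟩
      simp only [h, hiff, Fin.prod_univ_succ, Fin.cons_zero, Fin.cons_succ]
      split_ifs <;> simp
    · intro k _ hk
      refine Finset.sum_eq_zero fun c _ => if_neg fun h => hk ?_
      exact h.2 0

theorem isProper_semicompleteDumbbell {K : Type*} {b d p : ℕ} (hb : 1 ≤ b) {N : ℕ}
    (G : SimpleGraph (Fin N)) (hN : b + d + 1 + p = N)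
    (hG : ∀ i j, G.Adj i j ↔ i ≠ j ∧
      (((i.val + 1 = j.val ∧ j.val < b + 1) ∨ (i.val = 0 ∧ j.val + 1 = b + 1) ∨
        (b + 1 ≤ i.val + 1 ∧ i.val + 1 = j.val ∧ j.val ≤ b + d) ∨
        (b + d ≤ i.val ∧ b + d ≤ j.val)) ∨
      ((j.val + 1 = i.val ∧ i.val < b + 1) ∨ (j.val = 0 ∧ i.val + 1 = b + 1) ∨
        (b + 1 ≤ j.val + 1 ∧ j.val + 1 = i.val ∧ i.val ≤ b + d) ∨
        (b + d ≤ j.val ∧ b + d ≤ i.val))))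
    (u : Fin (b + d + 1) → K) (c : Fin p → K) :
    (∀ i j, G.Adj i j → Fin.append u c (Fin.cast hN.symm i) ≠ Fin.append u c (Fin.cast hN.symm j)) ↔
      (IsProperWalk u ∧ u 0 ≠ u ⟨b, by omega⟩) ∧
        (Function.Injective c ∧ ∀ i, c i ≠ u (Fin.last _)) := by
  subst hN
  simp only [Fin.cast_refl, id]
  constructor
  · intro h
    refine ⟨⟨fun i => ?_, ?_⟩, fun i j hij => ?_, fun i => ?_⟩
    · have := h (Fin.castAdd p i.castSucc) (Fin.castAdd p i.succ) (by
        rw [hG]; refine ⟨fun h => ?_, Or.inl ?_⟩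
        · have := congrArg Fin.val h; simp at this
        · simp; omega)
      simpa using this
    · have := h (Fin.castAdd p 0) (Fin.castAdd p ⟨b, by omega⟩) (by
        rw [hG]; refine ⟨fun h => ?_, Or.inl ?_⟩
        · have := congrArg Fin.val h; simp at this; omega
        · simp)
      rwa [Fin.append_left, Fin.append_left] at this
    · by_contra hne
      have := h (Fin.natAdd _ i) (Fin.natAdd _ j) (by
        rw [hG]; refine ⟨fun h => hne ?_, Or.inl ?_⟩
        · exact Fin.natAdd_injective _ _ h
        · simp; omega)
      simp [hij] at this
    · have := h (Fin.natAdd _ i) (Fin.castAdd p (Fin.last _)) (by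
        rw [hG]; refine ⟨fun h => ?_, Or.inl ?_⟩
        · have := congrArg Fin.val h; simp at this; omega
        · simp; omega)
      simpa using this
  · rintro ⟨⟨hw, hc⟩, hinj, hne⟩
    have key : ∀ i j : Fin (b + d + 1 + p), i ≠ j →
        ((i.val + 1 = j.val ∧ j.val < b + 1) ∨ (i.val = 0 ∧ j.val + 1 = b + 1) ∨
        (b + 1 ≤ i.val + 1 ∧ i.val + 1 = j.val ∧ j.val ≤ b + d) ∨
        (b + d ≤ i.val ∧ b + d ≤ j.val)) → Fin.append u c i ≠ Fin.append u c j := by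
      intro i j hij h
      induction i using Fin.addCases with
      | left i =>
        induction j using Fin.addCases with
        | left j =>
          have hij' : i.val ≠ j.val := fun h => hij (by rw [Fin.ext h])
          simp only [Fin.val_castAdd] at h
          rw [Fin.append_left, Fin.append_left]
          by_cases h1 : i.val + 1 = j.val
          · have := hw ⟨i.val, by omega⟩
            have e1 : (⟨i.val, by omega⟩ : Fin (b + d)).castSucc = i := rfl
            have e2 : (⟨i.val, by omega⟩ : Fin (b + d)).succ = j := Fin.ext h1
            rwa [e1, e2] at this
          · have h2 : i.val = 0 ∧ j.val = b := by omega
            have e1 : i = 0 := Fin.ext h2.1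
            have e2 : j = ⟨b, by omega⟩ := Fin.ext h2.2
            rw [e1, e2]; exact hc
        | right j =>
          simp only [Fin.val_castAdd, Fin.val_natAdd] at h
          -- Only the vertex `b + d` of the walk is adjacent to the rest of the clique.
          have e1 : i = Fin.last _ := Fin.ext (by simp; omega)
          rw [Fin.append_left, Fin.append_right, e1]
          exact (hne j).symm
      | right i =>
        induction j using Fin.addCases with
        | left j =>
          simp only [Fin.val_castAdd, Fin.val_natAdd] at h
          have e1 : j = Fin.last _ := Fin.ext (by simp; omega)
          rw [Fin.append_left, Fin.append_right, e1]
          exact hne i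
        | right j =>
          rw [Fin.append_right, Fin.append_right]
          exact fun h => hij (by rw [hinj h])
    intro i j hadj
    obtain ⟨h1, h2 | h2⟩ := (hG i j).1 hadj
    · exact key i j h1 h2
    · exact (key j i h1.symm h2).symm

omit [DecidableEq K] in
theorem colouringSum_eq_sum_append (x : K → R) {M p N : ℕ} (hN : M + p = N)
    (G : SimpleGraph (Fin N)) (Q : (Fin M → K) → Prop) (Q' : (Fin M → K) → (Fin p → K) → Prop)
    [DecidablePred Q] [∀ u, DecidablePred (Q' u)]
    (hQ : ∀ u c, (∀ i j, G.Adj i j →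
      Fin.append u c (Fin.cast hN.symm i) ≠ Fin.append u c (Fin.cast hN.symm j)) ↔
        Q u ∧ Q' u c) :
    colouringSum G x = ∑ u, if Q u then (∏ i, x (u i)) *
      ∑ c, if Q' u c then ∏ i, x (c i) else 0 else 0 := by
  classical
  subst hN
  rw [colouringSum, ← (Fin.appendEquiv M p).sum_comp, Fintype.sum_prod_type]
  refine Finset.sum_congr rfl fun u _ => ?_
  have h : ∀ c, (Fin.appendEquiv M p) (u, c) = Fin.append u c := fun _ => rfl
  have hQ' := hQ u
  simp only [Fin.cast_refl, id] at hQ'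
  simp only [h, hQ', Fin.prod_univ_add, Fin.append_left, Fin.append_right]
  by_cases hu : Q u
  · simp only [hu, true_and, if_true, Finset.mul_sum, mul_ite, mul_zero]
  · simp [hu]

theorem colouringSum_eq_dumbbellSeries (x : K → R) {b d p N : ℕ} (G : SimpleGraph (Fin N))
    (hN : b + d + 1 + p = N)
    (h : ∀ (u : Fin (b + d + 1) → K) (c : Fin p → K), (∀ i j, G.Adj i j →
        Fin.append u c (Fin.cast hN.symm i) ≠ Fin.append u c (Fin.cast hN.symm j)) ↔
      (IsProperWalk u ∧ u 0 ≠ u ⟨b, by omega⟩) ∧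
        (Function.Injective c ∧ ∀ i, c i ≠ u (Fin.last _))) :
    colouringSum G x = (p.factorial : R) * dumbbellSeries (elemSeries x Finset.univ) b d p := by
  rw [colouringSum_eq_sum_append x hN G (fun u => IsProperWalk u ∧ u 0 ≠ u ⟨b, by omega⟩)
    (fun u c => Function.Injective c ∧ ∀ i, c i ≠ u (Fin.last _)) h]
  have h : ∀ k, (∑ c : Fin p → K,
      if Function.Injective c ∧ ∀ i, c i ≠ k then ∏ i, x (c i) else 0) =
      ((p.factorial : R) • fun k => PowerSeries.coeff p (elemSeries x (Finset.univ.erase k))) k := by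
    intro k
    rw [Pi.smul_apply, smul_eq_mul, ← sum_injective]
    simp
  simp only [h]
  rw [sum_isProperWalk_tadpole, map_smul, map_smul, rootedCycleSum_coeff_elemSeries, smul_eq_mul]

theorem semicompleteDumbbell_adj (b d p : ℕ)
    (i j : Fin (((b + 1 : ℕ) : ℤ) + ((d : ℤ) - 1) + ((p + 1 : ℕ) : ℤ)).toNat) :
    (semicompleteDumbbell (b + 1) ((d : ℤ) - 1) (p + 1)).Adj i j ↔ i ≠ j ∧
      (((i.val + 1 = j.val ∧ j.val < b + 1) ∨ (i.val = 0 ∧ j.val + 1 = b + 1) ∨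
        (b + 1 ≤ i.val + 1 ∧ i.val + 1 = j.val ∧ j.val ≤ b + d) ∨
        (b + d ≤ i.val ∧ b + d ≤ j.val)) ∨
      ((j.val + 1 = i.val ∧ i.val < b + 1) ∨ (j.val = 0 ∧ i.val + 1 = b + 1) ∨
        (b + 1 ≤ j.val + 1 ∧ j.val + 1 = i.val ∧ i.val ≤ b + d) ∨
        (b + d ≤ j.val ∧ b + d ≤ i.val))) := by
  have h1 : ∀ y : ℕ, (y : ℤ) ≤ ((b + 1 : ℕ) : ℤ) + ((d : ℤ) - 1) ↔ y ≤ b + d := fun y => by omega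
  have h2 : ∀ y : ℕ, ((b + 1 : ℕ) : ℤ) + ((d : ℤ) - 1) ≤ (y : ℤ) ↔ b + d ≤ y := fun y => by omega
  rw [semicompleteDumbbell, SimpleGraph.fromRel_adj]
  simp only [h1, h2]

theorem colouringSum_semicompleteDumbbell (x : K → R) {b d p : ℕ} (hb : 1 ≤ b) :
    colouringSum (semicompleteDumbbell (b + 1) ((d : ℤ) - 1) (p + 1)) x =
      (p.factorial : R) * dumbbellSeries (elemSeries x Finset.univ) b d p :=
  have hN : b + d + 1 + p =
      (((b + 1 : ℕ) : ℤ) + ((d : ℤ) - 1) + ((p + 1 : ℕ) : ℤ)).toNat := by omega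
  colouringSum_eq_dumbbellSeries x _ hN
    (isProper_semicompleteDumbbell hb _ hN (semicompleteDumbbell_adj b d p))

end Walks

/-! ### From finitely many variables to symmetric functions. -/

section PowerSeriesRing

/-- Sets the variables `x_q, x_{q+1}, …` to zero. -/
noncomputable def restrictVars (q : ℕ) : MvPowerSeries ℕ ℚ →+* MvPowerSeries ℕ ℚ where
  toFun f := fun d => if d.support ⊆ Finset.range q then MvPowerSeries.coeff d f else 0
  map_zero' := by
    ext d
    change (if d.support ⊆ Finset.range q then MvPowerSeries.coeff d (0 : MvPowerSeries ℕ ℚ) else 0)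
      = _
    simp
  map_one' := by
    ext d
    change (if d.support ⊆ Finset.range q then MvPowerSeries.coeff d (1 : MvPowerSeries ℕ ℚ) else 0)
      = _
    rw [MvPowerSeries.coeff_one]
    by_cases hd : d = 0 <;> simp [hd]
  map_add' f g := by
    ext d
    change (if d.support ⊆ Finset.range q then MvPowerSeries.coeff d (f + g) else 0)
      = (if d.support ⊆ Finset.range q then MvPowerSeries.coeff d f else 0) +
        (if d.support ⊆ Finset.range q then MvPowerSeries.coeff d g else 0)
    split_ifs <;> simp
  map_mul' f g := by
    classical
    ext d
    refine Eq.trans ?_ (MvPowerSeries.coeff_mul d _ _).symm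
    change (if d.support ⊆ Finset.range q then MvPowerSeries.coeff d (f * g) else 0)
      = ∑ a ∈ Finset.HasAntidiagonal.antidiagonal d,
        (if a.1.support ⊆ Finset.range q then MvPowerSeries.coeff a.1 f else 0) *
        (if a.2.support ⊆ Finset.range q then MvPowerSeries.coeff a.2 g else 0)
    rw [MvPowerSeries.coeff_mul]
    have hs : ∀ a ∈ Finset.HasAntidiagonal.antidiagonal d, d.support = a.1.support ∪ a.2.support := by
      intro a ha
      rw [Finset.HasAntidiagonal.mem_antidiagonal] at ha
      rw [← ha]
      ext i
      simp only [Finsupp.mem_support_iff, Finsupp.add_apply, Finset.mem_union]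
      omega
    by_cases hd : d.support ⊆ Finset.range q
    · rw [if_pos hd]
      refine Finset.sum_congr rfl fun a ha => ?_
      rw [hs a ha, Finset.union_subset_iff] at hd
      rw [if_pos hd.1, if_pos hd.2]
    · rw [if_neg hd]
      refine (Finset.sum_eq_zero fun a ha => ?_).symm
      rw [hs a ha, Finset.union_subset_iff, not_and_or] at hd
      rcases hd with hd | hd
      · rw [if_neg hd, zero_mul]
      · rw [if_neg hd, mul_zero]

theorem coeff_restrictVars (q : ℕ) (f : MvPowerSeries ℕ ℚ) (d : ℕ →₀ ℕ) :
    MvPowerSeries.coeff d (restrictVars q f) =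
      if d.support ⊆ Finset.range q then MvPowerSeries.coeff d f else 0 := rfl

theorem eq_of_restrictVars_eq {f g : MvPowerSeries ℕ ℚ}
    (h : ∀ q, restrictVars q f = restrictVars q g) : f = g := by
  ext d
  obtain ⟨q, hq⟩ := d.support.exists_nat_subset_range
  have := congrArg (MvPowerSeries.coeff d) (h q)
  rwa [coeff_restrictVars, coeff_restrictVars, if_pos hq, if_pos hq] at this

theorem prod_X_eq_monomial {ι : Type*} (s : Finset ι) (f : ι → ℕ) :
    ∏ k ∈ s, (MvPowerSeries.X (f k) : MvPowerSeries ℕ ℚ) =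
      MvPowerSeries.monomial (∑ k ∈ s, Finsupp.single (f k) 1) 1 := by
  classical
  induction s using Finset.induction_on with
  | empty => simp
  | insert a s ha ih =>
    rw [Finset.prod_insert ha, Finset.sum_insert ha, ih, MvPowerSeries.X,
      MvPowerSeries.monomial_mul_monomial, one_mul]

theorem restrictVars_chromaticSymmetricFunction {V : Type*} [Fintype V] [DecidableEq V]
    (G : SimpleGraph V) (q : ℕ) : restrictVars q (chromaticSymmetricFunction G) =
      colouringSum G fun k : Fin q => (MvPowerSeries.X k.val : MvPowerSeries ℕ ℚ) := by
  classical
  ext d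
  have h1 : MvPowerSeries.coeff d (colouringSum G fun k : Fin q =>
      (MvPowerSeries.X k.val : MvPowerSeries ℕ ℚ)) =
      ((Finset.univ.filter fun κ : V → Fin q => (∀ a b, G.Adj a b → κ a ≠ κ b) ∧
        ∑ v, Finsupp.single (κ v).val 1 = d).card : ℚ) := by
    rw [colouringSum, map_sum, Finset.card_filter, Nat.cast_sum]
    refine Finset.sum_congr rfl fun κ _ => ?_
    rw [ite_and]
    split_ifs with _ h2
    · rw [prod_X_eq_monomial, MvPowerSeries.coeff_monomial, if_pos h2.symm, Nat.cast_one]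
    · rw [prod_X_eq_monomial, MvPowerSeries.coeff_monomial, if_neg (Ne.symm h2), Nat.cast_zero]
    · simp
  have hmem : ∀ (κ : V → ℕ), ∑ v, Finsupp.single (κ v) 1 = d → ∀ v, κ v ∈ d.support := by
    rintro κ rfl v
    rw [Finsupp.mem_support_iff, Finsupp.finsetSum_apply]
    intro h0
    have := (Finset.sum_eq_zero_iff.mp h0) v (Finset.mem_univ v)
    simp at this
  rw [h1, coeff_restrictVars]
  split_ifs with hd
  · change (Nat.card {κ : G.Coloring ℕ // ∑ v, Finsupp.single (κ v) 1 = d} : ℚ) = _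
    rw [← Fintype.card_subtype, ← Nat.card_eq_fintype_card]
    congr 1
    refine Nat.card_congr
      { toFun := fun κ => ⟨fun v => ⟨κ.1 v, Finset.mem_range.1 (hd (hmem κ.1 κ.2 v))⟩,
          fun a b hab h => κ.1.valid hab (congrArg Fin.val h), κ.2⟩
        invFun := fun κ => ⟨SimpleGraph.Coloring.mk (fun v => (κ.1 v).val)
          fun hab h => κ.2.1 _ _ hab (Fin.ext h), κ.2.2⟩
        left_inv := fun κ => rfl
        right_inv := fun κ => rfl }
  · symm
    rw [Nat.cast_eq_zero, Finset.card_eq_zero, Finset.filter_eq_empty_iff]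
    rintro κ - ⟨-, h⟩
    refine hd fun i hi => ?_
    rw [← h, Finsupp.mem_support_iff, Finsupp.finsetSum_apply] at hi
    obtain ⟨v, -, hv⟩ := Finset.exists_ne_zero_of_sum_ne_zero hi
    rw [Finsupp.single_apply, ne_eq, ite_eq_right_iff, Classical.not_imp] at hv
    rw [← hv.1]
    exact Finset.mem_range.2 (κ v).isLt

theorem coeff_elemSeries {K R : Type*} [DecidableEq K] [CommRing R] (x : K → R) (A : Finset K)
    (i : ℕ) : PowerSeries.coeff i (elemSeries x A) =
      ∑ s ∈ A.powersetCard i, ∏ k ∈ s, x k := by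
  rw [elemSeries, Finset.prod_one_add, map_sum, Finset.powersetCard_eq_filter, Finset.sum_filter]
  refine Finset.sum_congr rfl fun s _ => ?_
  rw [Finset.prod_mul_distrib, ← map_prod, Finset.prod_const, PowerSeries.coeff_C_mul,
    PowerSeries.coeff_X_pow]
  simp [eq_comm]

theorem restrictVars_elemSymm (q i : ℕ) : restrictVars q (elemSymm i) =
    PowerSeries.coeff i (elemSeries (fun k : Fin q => (MvPowerSeries.X k.val : MvPowerSeries ℕ ℚ))
      Finset.univ) := by
  classical
  ext d
  rw [coeff_elemSeries, map_sum, coeff_restrictVars]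
  have hval : ∀ (s : Finset (Fin q)) (j : ℕ),
      (∑ k ∈ s, Finsupp.single k.val 1 : ℕ →₀ ℕ) j = if ∃ k ∈ s, k.val = j then 1 else 0 := by
    intro s j
    simp only [Finsupp.finsetSum_apply, Finsupp.single_apply]
    split_ifs with h
    · obtain ⟨k, hk, rfl⟩ := h
      rw [Finset.sum_eq_single k]
      · simp
      · intro b _ hb
        rw [if_neg (fun h => hb (Fin.ext h))]
      · exact fun h => absurd hk h
    · exact Finset.sum_eq_zero fun k hk => if_neg fun hkj => h ⟨k, hk, hkj⟩
  have hdeg : ∀ s : Finset (Fin q),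
      (∑ k ∈ s, Finsupp.single k.val 1 : ℕ →₀ ℕ).degree = s.card := by
    intro s
    rw [map_sum]; simp
  simp only [prod_X_eq_monomial, MvPowerSeries.coeff_monomial]
  change (if d.support ⊆ Finset.range q then
    (if (∀ j, d j ≤ 1) ∧ d.degree = i then (1 : ℚ) else 0) else 0) = _
  by_cases hd : d.support ⊆ Finset.range q ∧ ∀ j, d j ≤ 1
  · obtain ⟨hd1, hd2⟩ := hd
    have hs : d = ∑ k ∈ Finset.univ.filter (fun k : Fin q => d k.val ≠ 0),
        Finsupp.single k.val 1 := by
      ext j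
      rw [hval]
      split_ifs with h
      · obtain ⟨k, hk, rfl⟩ := h
        have := hd2 k.val
        have := (Finset.mem_filter.1 hk).2
        omega
      · by_contra hj
        have hjq := Finset.mem_range.1 (hd1 (Finsupp.mem_support_iff.2 hj))
        exact h ⟨⟨j, hjq⟩, by simpa using hj, rfl⟩
    have huniq : ∀ s : Finset (Fin q), d = ∑ k ∈ s, Finsupp.single k.val 1 ↔
        s = Finset.univ.filter (fun k : Fin q => d k.val ≠ 0) := by
      intro s
      constructor
      · intro h
        ext k
        rw [Finset.mem_filter, h, hval]
        have : (∃ k' ∈ s, k'.val = k.val) ↔ k ∈ s :=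
          ⟨fun ⟨k', h1, h2⟩ => Fin.ext h2 ▸ h1, fun h => ⟨k, h, rfl⟩⟩
        simp [this]
      · rintro rfl; exact hs
    have hcard : (Finset.univ.filter (fun k : Fin q => d k.val ≠ 0)).card = d.degree := by
      rw [← hdeg, ← hs]
    simp only [huniq, Finset.sum_ite_eq', Finset.mem_powersetCard, Finset.subset_univ, true_and,
      hcard, hd1, hd2, if_true, implies_true]
  · have hne : ∀ s : Finset (Fin q), d ≠ ∑ k ∈ s, Finsupp.single k.val 1 := by
      rintro s rfl
      refine hd ⟨fun j hj => ?_, fun j => ?_⟩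
      · rw [Finsupp.mem_support_iff, hval] at hj
        split_ifs at hj with h
        · obtain ⟨k, -, rfl⟩ := h
          exact Finset.mem_range.2 k.isLt
        · exact absurd rfl hj
      · rw [hval]; split_ifs <;> simp
    simp only [hne, if_false, Finset.sum_const_zero]
    rw [← ite_and, if_neg fun h => hd ⟨h.1, h.2.1⟩]

/-- The generating function of the elementary symmetric functions. -/
noncomputable def elemSymmSeries : PowerSeries (MvPowerSeries ℕ ℚ) := PowerSeries.mk elemSymm

theorem elemSymm_zero : elemSymm 0 = 1 := by
  ext d
  rw [MvPowerSeries.coeff_one]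
  change (open Classical in if (∀ j, d j ≤ 1) ∧ d.degree = 0 then (1 : ℚ) else 0) = _
  have : ((∀ j, d j ≤ 1) ∧ d.degree = 0) ↔ d = 0 := by
    rw [Finsupp.degree_eq_zero_iff]
    exact ⟨fun h => h.2, fun h => ⟨by simp [h], h⟩⟩
  simp only [this]

/-- `dumbbellSeries` commutes with ring homomorphisms, so the identity in `q` variables for every
`q` lifts to power series. -/
theorem chromaticSymmetricFunction_semicompleteDumbbell {b d p : ℕ} (hb : 1 ≤ b) :
    chromaticSymmetricFunction (semicompleteDumbbell (b + 1) ((d : ℤ) - 1) (p + 1)) =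
      (p.factorial : MvPowerSeries ℕ ℚ) * dumbbellSeries elemSymmSeries b d p := by
  refine eq_of_restrictVars_eq fun q => ?_
  rw [restrictVars_chromaticSymmetricFunction, colouringSum_semicompleteDumbbell _ hb, map_mul,
    map_natCast, map_dumbbellSeries _ (by simp [elemSymmSeries, elemSymm_zero])]
  congr 2
  ext1 i
  rw [PowerSeries.coeff_map, elemSymmSeries, PowerSeries.coeff_mk, restrictVars_elemSymm]

theorem isEPositive_of_mem_closure {f : MvPowerSeries ℕ ℚ}
    (hf : f ∈ Subsemiring.closure (Set.range elemSymm)) : IsEPositive f := by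
  rw [Subsemiring.mem_closure_iff] at hf
  induction hf using AddSubmonoid.closure_induction with
  | zero => exact ⟨0, fun _ => le_rfl, by simp⟩
  | add f g _ _ hf hg =>
    obtain ⟨c, hc, rfl⟩ := hf
    obtain ⟨c', hc', rfl⟩ := hg
    refine ⟨c + c', fun p => add_nonneg (hc p) (hc' p), ?_⟩
    rw [Finsupp.sum_add_index'] <;> simp [add_smul]
  | mem f hf =>
    -- Parts of a partition are positive, so factors `e_0 = 1` have to be dropped.
    suffices ∃ s : Multiset ℕ, (∀ i ∈ s, 0 < i) ∧ f = (s.map elemSymm).prod by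
      obtain ⟨s, hs, rfl⟩ := this
      refine ⟨Finsupp.single ⟨s.sum, s, hs _, rfl⟩ 1, fun p => ?_, ?_⟩
      · classical
        rw [Finsupp.single_apply]; split_ifs <;> simp
      · simp [elemSymmPart]
    induction hf using Submonoid.closure_induction with
    | one => exact ⟨0, by simp, by simp⟩
    | mul f g _ _ hf hg =>
      obtain ⟨s, hs, rfl⟩ := hf
      obtain ⟨t, ht, rfl⟩ := hg
      refine ⟨s + t, fun i hi => ?_, by simp⟩
      rcases Multiset.mem_add.1 hi with hi | hi
      exacts [hs i hi, ht i hi]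
    | mem f hf =>
      obtain ⟨i, rfl⟩ := hf
      rcases Nat.eq_zero_or_pos i with rfl | hi
      · exact ⟨0, by simp, by simp [elemSymm_zero]⟩
      · exact ⟨{i}, by simpa using hi, by simp⟩

theorem isEPositive_semicompleteDumbbell {b d p : ℕ} (hb : 1 ≤ b) : IsEPositive
    (chromaticSymmetricFunction (semicompleteDumbbell (b + 1) ((d : ℤ) - 1) (p + 1))) := by
  rw [chromaticSymmetricFunction_semicompleteDumbbell hb]
  refine isEPositive_of_mem_closure (Subsemiring.mul_mem _ (natCast_mem _ _) ?_)
  refine dumbbellSeries_mem (by simp [elemSymmSeries, elemSymm_zero]) (fun i => ?_) b d p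
  rw [elemSymmSeries, PowerSeries.coeff_mk]
  exact Subsemiring.subset_closure ⟨i, rfl⟩

end PowerSeriesRing

/-! ### Recovering the parameters. -/

section Distinguishing

/-- After restriction to `q` variables both sides are polynomials, so every variable may be set to
`t`. -/
theorem colouringSum_eq_of_chromaticSymmetricFunction_eq {V V' : Type*} [Fintype V] [Fintype V']
    [DecidableEq V] [DecidableEq V'] {G : SimpleGraph V} {G' : SimpleGraph V'}
    (h : chromaticSymmetricFunction G = chromaticSymmetricFunction G') (q : ℕ) (t : ℚ) :
    colouringSum G (fun _ : Fin q => t) = colouringSum G' (fun _ : Fin q => t) := by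
  have h1 := congrArg (restrictVars q) h
  rw [restrictVars_chromaticSymmetricFunction, restrictVars_chromaticSymmetricFunction] at h1
  have h2 : ∀ k : Fin q, (MvPowerSeries.X k.val : MvPowerSeries ℕ ℚ) =
      MvPolynomial.coeToMvPowerSeries.ringHom (MvPolynomial.X k.val) := fun k => by simp
  simp only [h2] at h1
  rw [← map_colouringSum, ← map_colouringSum] at h1
  have h3 := MvPolynomial.coe_injective ℕ ℚ h1
  have h4 := congrArg (MvPolynomial.eval fun _ => t) h3
  rw [map_colouringSum, map_colouringSum] at h4
  simpa using h4

/-- With unit weights `step` is the adjacency matrix of the complete graph on `y + 1` colours, with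
eigenvalues `y` and `-1`. -/
theorem step_pow_single_one (y j : ℕ) (k c : Fin (y + 1)) :
    ((y : ℚ) + 1) * (step (fun _ : Fin (y + 1) => (1 : ℚ)) ^ j) (Pi.single k 1) c =
      y ^ j - (-1) ^ j + (y + 1) * (-1) ^ j * (if c = k then 1 else 0) := by
  induction j generalizing c with
  | zero => simp [Pi.single_apply]
  | succ j ih =>
    rw [pow_succ', Module.End.mul_apply, step_apply, mul_sub, Finset.mul_sum]
    simp only [one_mul, ih, Finset.sum_add_distrib, ← Finset.mul_sum, Finset.sum_ite_eq',
      Finset.mem_univ, if_true, Finset.sum_const, Finset.card_univ, Fintype.card_fin, nsmul_eq_mul]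
    push_cast
    ring

theorem step_pow_const (y j : ℕ) (a : ℚ) :
    (step (fun _ : Fin (y + 1) => (1 : ℚ)) ^ j) (fun _ => a) = fun _ => y ^ j * a := by
  induction j with
  | zero => simp
  | succ j ih =>
    rw [pow_succ', Module.End.mul_apply, ih]
    funext k
    rw [step_apply]
    simp
    ring

/-- The number of colourings of a semicomplete dumbbell with `y + 1` colours. -/
theorem colouringSum_one_semicompleteDumbbell {b d p : ℕ} (hb : 1 ≤ b) (y : ℕ) :
    colouringSum (semicompleteDumbbell (b + 1) ((d : ℤ) - 1) (p + 1))
      (fun _ : Fin (y + 1) => (1 : ℚ)) =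
      p.factorial * (y.choose p * (y ^ (d + b + 1) + (-1) ^ (b + 1) * y ^ (d + 1))) := by
  have h1 : ∀ k : Fin (y + 1), PowerSeries.coeff p
      (elemSeries (fun _ : Fin (y + 1) => (1 : ℚ)) (Finset.univ.erase k)) = y.choose p := by
    intro k
    rw [coeff_elemSeries]
    simp
  rw [colouringSum_semicompleteDumbbell _ hb, ← rootedCycleSum_coeff_elemSeries]
  simp only [h1]
  rw [step_pow_const, rootedCycleSum_eq, step_pow_const, closedWalkSum]
  congr 1
  have h2 : ∀ k, (step (fun _ : Fin (y + 1) => (1 : ℚ)) ^ b) (Pi.single k 1) k =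
      (y ^ b - (-1) ^ b + (y + 1) * (-1) ^ b) / (y + 1) := by
    intro k
    have h := step_pow_single_one y b k k
    rw [if_pos rfl, mul_one] at h
    rw [eq_div_iff (by positivity), mul_comm, h]
  simp only [h2, Finset.sum_const, Finset.card_univ, Fintype.card_fin, nsmul_eq_mul]
  have : (y : ℚ) + 1 ≠ 0 := by positivity
  push_cast
  field_simp
  ring

theorem colouringSum_one_semicompleteDumbbell_pos {b d p : ℕ} (hb : 1 ≤ b) (hp : 2 ≤ p) :
    0 < colouringSum (semicompleteDumbbell (b + 1) ((d : ℤ) - 1) (p + 1))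
      (fun _ : Fin (p + 1) => (1 : ℚ)) := by
  rw [colouringSum_one_semicompleteDumbbell hb, Nat.choose_self, Nat.cast_one, one_mul]
  refine mul_pos (by positivity) ?_
  have hp' : (1 : ℚ) < p := by exact_mod_cast hp
  have h1 : (p : ℚ) ^ (d + 1) < p ^ (d + b + 1) := pow_lt_pow_right₀ hp' (by omega)
  have h2 : (0 : ℚ) < p ^ (d + 1) := by positivity
  rcases neg_one_pow_eq_or ℚ (b + 1) with h | h <;> rw [h] <;> linarith

theorem eq_of_chromaticSymmetricFunction_eq {b d p b' d' p' : ℕ} (hb : 1 ≤ b) (hb' : 1 ≤ b')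
    (hp : 2 ≤ p) (hp' : 2 ≤ p')
    (h : chromaticSymmetricFunction (semicompleteDumbbell (b + 1) ((d : ℤ) - 1) (p + 1)) =
      chromaticSymmetricFunction (semicompleteDumbbell (b' + 1) ((d' : ℤ) - 1) (p' + 1))) :
    b = b' ∧ d = d' ∧ p = p' := by
  have hcount := colouringSum_eq_of_chromaticSymmetricFunction_eq h
  -- The clique makes `p + 1` the least number of colours that suffices.
  have hle : p' ≤ p := by
    by_contra! hlt
    have := colouringSum_one_semicompleteDumbbell_pos (d := d) hb hp
    rw [hcount, colouringSum_one_semicompleteDumbbell hb', Nat.choose_eq_zero_of_lt hlt] at this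
    simp at this
  have hge : p ≤ p' := by
    by_contra! hlt
    have := colouringSum_one_semicompleteDumbbell_pos (d := d') hb' hp'
    rw [← hcount, colouringSum_one_semicompleteDumbbell hb, Nat.choose_eq_zero_of_lt hlt] at this
    simp at this
  obtain rfl : p = p' := le_antisymm hge hle
  -- Scaling all variables by `2` multiplies the count by `2` to the number of vertices.
  have hN : d + b + 1 = d' + b' + 1 := by
    have h2 := hcount (p + 1) 2
    rw [colouringSum_const, colouringSum_const _ (2 : ℚ), hcount] at h2
    have h3 := mul_right_cancel₀ (colouringSum_one_semicompleteDumbbell_pos hb' hp).ne' h2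
    have h4 := pow_right_injective₀ (by norm_num : (0 : ℚ) < 2) (by norm_num) h3
    simp only [Fintype.card_fin] at h4
    omega
  have h1 := hcount (p + 1) 1
  rw [colouringSum_one_semicompleteDumbbell hb, colouringSum_one_semicompleteDumbbell hb',
    Nat.choose_self, hN] at h1
  have h2 := mul_left_cancel₀ (by positivity : (p.factorial : ℚ) ≠ 0) h1
  rw [Nat.cast_one, one_mul, one_mul, add_right_inj] at h2
  -- The signs depend on `b` and `b'`, which are not yet known to agree; absolute values remove
  -- them.
  have h3 := congrArg abs h2
  rw [abs_mul, abs_mul, abs_neg_one_pow, abs_neg_one_pow, one_mul, one_mul,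
    abs_of_nonneg (by positivity), abs_of_nonneg (by positivity)] at h3
  have h4 : p ^ (d + 1) = p ^ (d' + 1) := by exact_mod_cast h3
  have h5 := Nat.pow_right_injective hp h4
  omega

end Distinguishing

theorem mainTheorem10 :
    (∀ (m n : ℕ) (l : ℤ), 3 ≤ m → 3 ≤ n → -1 ≤ l →
      IsEPositive (chromaticSymmetricFunction (semicompleteDumbbell m l n))) ∧
    (∀ (m n m' n' : ℕ) (l l' : ℤ), 3 ≤ m → 3 ≤ n → -1 ≤ l → 3 ≤ m' → 3 ≤ n' → -1 ≤ l' →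
      IsEmpty (semicompleteDumbbell m l n ≃g semicompleteDumbbell m' l' n') →
      chromaticSymmetricFunction (semicompleteDumbbell m l n) ≠
        chromaticSymmetricFunction (semicompleteDumbbell m' l' n')) := by
  have hparam : ∀ (m n : ℕ) (l : ℤ), 3 ≤ m → 3 ≤ n → -1 ≤ l →
      ∃ b d p : ℕ, 2 ≤ b ∧ 2 ≤ p ∧ m = b + 1 ∧ l = (d : ℤ) - 1 ∧ n = p + 1 := fun m n l hm hn hl =>
    ⟨m - 1, (l + 1).toNat, n - 1, by omega, by omega, by omega, by omega, by omega⟩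
  constructor
  · intro m n l hm hn hl
    obtain ⟨b, d, p, hb, -, rfl, rfl, rfl⟩ := hparam m n l hm hn hl
    exact isEPositive_semicompleteDumbbell (by omega)
  · intro m n m' n' l l' hm hn hl hm' hn' hl' hiso h
    obtain ⟨b, d, p, hb, hp, rfl, rfl, rfl⟩ := hparam m n l hm hn hl
    obtain ⟨b', d', p', hb', hp', rfl, rfl, rfl⟩ := hparam m' n' l' hm' hn' hl'
    obtain ⟨rfl, rfl, rfl⟩ :=
      eq_of_chromaticSymmetricFunction_eq (by omega) (by omega) hp hp' h
    exact hiso.false (SimpleGraph.Iso.refl)
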